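/- Let $K$ be a number field of degree $d$ with ring of integers $\mathcal O_K$, and fix a $\mathbb Z$-basis $e_1,\dots,e_d$ of $\mathcal O_K$. For $a=\alpha_1e_1+\dots+\alpha_de_d\in\mathcal O_K$ ($\alpha_j\in\mathbb Z$) put $\|a\|=|\alpha_1|+\dots+|\alpha_d|$. For a nonzero ideal $\mathfrak a$ let $N(\mathfrak a)=\#\mathcal O_K/\mathfrak a$, and write $\gcd(\mathfrak a,\mathfrak b)=\mathfrak a+\mathfrak b$ and $\operatorname{lcm}$ for the intersection of ideals; $\mathfrak p$ always denotes a nonzero prime ideal. Let $\mu$ be the Möbius function on ideals, i.e. $\mu(\mathfrak a)=(-1)^m$ if $\mathfrak a$ is a product of $m\ge 0$ distinct prime ideals and $\mu(\mathfrak a)=0$ otherwise. For $k\ge 2$ and $a\in\mathcal O_K$ let $\mu^{(k)}(a)=1$ if $a\notin\mathfrak p^k$ for every $\mathfrak p$ (that is, $a$ is $k$-free), and $\mu^{(k)}(a)=0$ otherwise. Let $k\ge2$ and $s\ge 0$ be integers, $\mathfrak b$ a nonzero ideal, $\underline a=(a_1,\dots,a_s)\in\mathcal O_K^s$, and put $$M_k(x;\mathfrak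 b;\underline a)=\sum_{a\in\mathfrak b,\ \|a\|\le x}\mu^{(k)}(a+a_1)\cdots\mu^{(k)}(a+a_s),$$ $$D(\mathfrak p^k,\mathfrak b\mid\underline a)=\#\{c \bmod \mathfrak p^k:\ c\equiv a_i \bmod \mathfrak p^k\text{ for some } i,\ \text{and } c\in\gcd(\mathfrak p^k,\mathfrak b)\}.$$ (1) If $D(\mathfrak p^k,\mathfrak b\mid\underline a)=N(\mathfrak p^k)/N(\gcd(\mathfrak p^k,\mathfrak b))$ for some $\mathfrak p$, then $M_k(x;\mathfrak b;\underline a)=0$ for every $x$. (2) Suppose that there is no such $\mathfrak p$. Then the series over all $s$-tuples $\underline{\mathfrak n}=(\mathfrak n_1,\dots,\mathfrak n_s)$ of nonzero ideals $$S_{k,\mathfrak b}(\underline a)=\sum_{\underline{\mathfrak n}}\frac{\mu(\mathfrak n_1)\cdots\mu(\mathfrak n_s)}{N(\operatorname{lcm}(\mathfrak b,\mathfrak n_1^k,\dots,\mathfrak n_s^k))}\,E(\underline{\mathfrak n}),$$ where $E(\underline{\mathfrak n})=1$ if there is $c\in\mathfrak b$ with $c+a_i\in\mathfrak n_i^k$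 for all $i$, and $E(\underline{\mathfrak n})=0$ otherwise, converges absolutely, its sum is positive, and $$S_{k,\mathfrak b}(\underline a)=\frac1{N(\mathfrak b)}\prod_{\mathfrak p^k\not\supseteq\mathfrak b}\left(1-\frac{N(\gcd(\mathfrak p^k,\mathfrak b))\,D(\mathfrak p^k,\mathfrak b\mid\underline a)}{N(\mathfrak p^k)}\right),$$ where the product converges unconditionally. (3) For every $\varepsilon>0$ there is a constant $C>0$, depending only on $K$, the basis $e_1,\dots,e_d$ and $\varepsilon$, such that for all $k\ge2$, $s\ge0$, $\mathfrak b\neq 0$ and $\underline a$ as in (2), $$\left|M_k(x;\mathfrak b;\underline a)-S_{k,\mathfrak b}(\underline a)\,\frac{2^d}{d!}\,x^d\right|\le C\,x^{\,d-\frac{k-1}{k+2sk-1}+\varepsilon}$$ for all real $x\ge\max(1,\|a_1\|,\dots,\|a_s\|)$. -/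

import Mathlib

open NumberField IsDedekindDomain

noncomputable section

namespace KFree

variable {K : Type*} [Field K] [NumberField K]

/-- The indicator `μ^(k)` of `k`-free ideals: it is `1` if no `k`-th power of a (nonzero) prime
ideal contains (that is, divides) the ideal, and `0` otherwise. -/
def kfreeIdeal (k : ℕ) (I : Ideal (𝓞 K)) : ℕ :=
  open scoped Classical in
  if ∀ p : HeightOneSpectrum (𝓞 K), ¬ I ≤ p.asIdeal ^ k then 1 else 0

/-- `μ^(k)(a) = μ^(k)((a))` for an integer `a` of `K`. -/
def kfree (k : ℕ) (a : 𝓞 K) : ℕ := kfreeIdeal k (Ideal.span {a})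

/-- The geometric norm `‖a‖ = |α_1| + ⋯ + |α_d|` of `a = ∑ α_j e_j` with respect to a
`ℤ`-basis `e` of the ring of integers. -/
def geomNorm {d : ℕ} (e : Module.Basis (Fin d) ℤ (𝓞 K)) (a : 𝓞 K) : ℤ :=
  ∑ j, |e.repr a j|

/-- The ball `B_x = {a : ‖a‖ ≤ x}` of the geometric norm. -/
def ball {d : ℕ} (e : Module.Basis (Fin d) ℤ (𝓞 K)) (x : ℝ) : Set (𝓞 K) :=
  {a | (geomNorm e a : ℝ) ≤ x}

lemma ball_finite {d : ℕ} (e : Module.Basis (Fin d) ℤ (𝓞 K)) (x : ℝ) : (ball e x).Finite := by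
  have hfin : (Set.pi Set.univ fun _ : Fin d => Set.Icc (-⌊x⌋) ⌊x⌋).Finite :=
    Set.Finite.pi fun _ => Set.finite_Icc _ _
  refine (hfin.preimage (f := fun a : 𝓞 K => (e.repr a : Fin d → ℤ)) ?_).subset ?_
  · intro a _ b _ hab
    exact e.repr.injective (DFunLike.coe_injective hab)
  · intro a ha j _
    have h1 : geomNorm e a ≤ ⌊x⌋ := Int.le_floor.mpr ha
    have h2 : |e.repr a j| ≤ geomNorm e a :=
      Finset.single_le_sum (f := fun j => |e.repr a j|) (fun _ _ => abs_nonneg _)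
        (Finset.mem_univ j)
    exact abs_le.mp (h2.trans h1)

/-- `M_k(x; 𝔟; a) = ∑ μ^(k)(a + a_1) ⋯ μ^(k)(a + a_s)`, the sum being over the `a ∈ 𝔟` with
`‖a‖ ≤ x`. -/
def M {d : ℕ} (e : Module.Basis (Fin d) ℤ (𝓞 K)) (k : ℕ) (x : ℝ) (b : Ideal (𝓞 K))
    {s : ℕ} (a : Fin s → 𝓞 K) : ℕ :=
  open scoped Classical in
  ∑ c ∈ (ball_finite e x).toFinset with c ∈ b, ∏ i, kfree k (c + a i)

/-- `D(𝔞, 𝔟 ∣ a)`: the number of residue classes `c mod 𝔞` such that `c ≡ a_i mod 𝔞` for some `i`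
and `c ∈ gcd(𝔞, 𝔟) = 𝔞 + 𝔟`. -/
def D (A b : Ideal (𝓞 K)) {s : ℕ} (a : Fin s → 𝓞 K) : ℕ :=
  Set.ncard {ρ : 𝓞 K ⧸ A | ∃ c : 𝓞 K, Ideal.Quotient.mk A c = ρ ∧ (∃ i, c - a i ∈ A) ∧ c ∈ A ⊔ b}

/-- The `p`-adic obstruction `D(𝔭^k, 𝔟 ∣ a) = N(𝔭^k) / N(gcd(𝔭^k, 𝔟))`. -/
def Obstructed (k : ℕ) (b : Ideal (𝓞 K)) {s : ℕ} (a : Fin s → 𝓞 K)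
    (p : HeightOneSpectrum (𝓞 K)) : Prop :=
  (D (p.asIdeal ^ k) b a : ℝ) =
    (Ideal.absNorm (p.asIdeal ^ k) : ℝ) / (Ideal.absNorm (p.asIdeal ^ k ⊔ b) : ℝ)

/-- The symbol `E(𝔟, 𝔫_1, …, 𝔫_s; 0, a_1, …, a_s)`: it is `1` if some `c ∈ 𝔟` satisfies
`c + a_i ≡ 0 mod 𝔫_i` for all `i`, and `0` otherwise. -/
def E (b : Ideal (𝓞 K)) {s : ℕ} (n : Fin s → Ideal (𝓞 K)) (a : Fin s → 𝓞 K) : ℕ :=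
  open scoped Classical in
  if ∃ c ∈ b, ∀ i, c + a i ∈ n i then 1 else 0

/-- The general term of the series that defines `S_{k,𝔟}(a)`; `n` runs over the `s`-tuples of
nonzero ideals and the least common multiple of ideals is their intersection. -/
def STerm (k : ℕ) (b : Ideal (𝓞 K)) {s : ℕ} (a : Fin s → 𝓞 K)
    (n : Fin s → {I : Ideal (𝓞 K) // I ≠ ⊥}) : ℝ :=
  (∏ i, (UniqueFactorizationMonoid.moebius (n i : Ideal (𝓞 K)) : ℝ)) /
      (Ideal.absNorm (b ⊓ ⨅ i, (n i : Ideal (𝓞 K)) ^ k) : ℝ) *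
    (E b (fun i => (n i : Ideal (𝓞 K)) ^ k) a : ℝ)

/-- `S_{k,𝔟}(a)`, the sum over all `s`-tuples of nonzero ideals. -/
def S (k : ℕ) (b : Ideal (𝓞 K)) {s : ℕ} (a : Fin s → 𝓞 K) : ℝ :=
  ∑' n : Fin s → {I : Ideal (𝓞 K) // I ≠ ⊥}, STerm k b a n

/-- The Euler factor `1 - N(gcd(𝔭^k, 𝔟)) D(𝔭^k, 𝔟 ∣ a) / N(𝔭^k)`. -/
def eulerFactor (k : ℕ) (b : Ideal (𝓞 K)) {s : ℕ} (a : Fin s → 𝓞 K)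
    (p : HeightOneSpectrum (𝓞 K)) : ℝ :=
  1 - (Ideal.absNorm (p.asIdeal ^ k ⊔ b) : ℝ) * (D (p.asIdeal ^ k) b a : ℝ) /
    (Ideal.absNorm (p.asIdeal ^ k) : ℝ)

end KFree

end

namespace KFree

set_option linter.unusedSectionVars false

/-! ### Counting points of lattice cosets in balls of the `ℓ¹` norm -/

/-! Only squarefree ideals contribute to the Möbius sums, and they are the products `rad A` of
finite sets `A` of primes. For `c ≠ 0` the indicator of being `k`-free is the sum of `(-1)^|A|` over
all `A` with `c ∈ rad A ^ k`. Everything follows from two uses of this expansion.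

Singular series: restrict the tuples to subsets of a finite set `P` of primes. By
inclusion-exclusion on residue classes (`sum_radTerm_mul_absNorm`) the partial sum, times `N(b)`, is
the proportion of classes of `b` modulo `b ⊓ rad P ^ k` that avoid every `p ^ k` after each shift.
By the Chinese remainder theorem (`ncard_goodClasses_eq_prod`) this proportion is the product over
`P` of the Euler factors. Absolute convergence allows `P` to grow. An obstruction at `p` means that
the factor at `p` is zero, that is, that no class of `b` is good; without obstructions all factors
are positive and differ from 1 by summable amounts, so the product is positive.

Asymptotics: truncate the expansion to `N(rad A) ≤ y`. Each tuple then asks for the points of one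
coset of an ideal in a ball (or of none), and `exists_ncard_idealBall` counts them with error
`O(x^(d-1))` uniformly in the ideal. The truncated product is wrong only if some `c + a_i` is zero,
which happens at most `s` times, or lies in `rad A ^ k` with `N(rad A) > y`. The latter points are
counted by `exists_ncard_badSet_le`, which needs the bound `O(x^d / N(I))` for nonzero points
without an additive error, since the ideals have unbounded norm. The choice `y = x^(1/(k+2sk-1))`
gives the exponent.

Uniformity: no constant involves `k` or `b`. The constants do depend on `s`, but once `s ≥ 1/ε` the
power saving is at most `ε` and the trivial bound suffices, so finitely many `s` remain. -/

lemma pow_succ_sub_pow_succ_le {a b : ℝ} (hb : 0 ≤ b) (hab : b ≤ a) (n : ℕ) :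
    a ^ (n + 1) - b ^ (n + 1) ≤ (n + 1) * a ^ n * (a - b) := by
  induction n with
  | zero => simp
  | succ n ih =>
    have h1 : b ^ (n + 1) ≤ a ^ (n + 1) := pow_le_pow_left₀ hb hab _
    have h2 := mul_le_mul_of_nonneg_left ih (hb.trans hab)
    have h3 := mul_le_mul_of_nonneg_right h1 (sub_nonneg.2 hab)
    push_cast
    calc a ^ (n + 1 + 1) - b ^ (n + 1 + 1)
        = a * (a ^ (n + 1) - b ^ (n + 1)) + b ^ (n + 1) * (a - b) := by ring
      _ ≤ a * ((n + 1) * a ^ n * (a - b)) + a ^ (n + 1) * (a - b) := add_le_add h2 h3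
      _ = _ := by ring

lemma le_pow_succ_sub_pow_succ {a b : ℝ} (hb : 0 ≤ b) (hab : b ≤ a) (n : ℕ) :
    (n + 1) * b ^ n * (a - b) ≤ a ^ (n + 1) - b ^ (n + 1) := by
  induction n with
  | zero => simp
  | succ n ih =>
    have h0 : 0 ≤ a ^ (n + 1) - b ^ (n + 1) := sub_nonneg.2 (pow_le_pow_left₀ hb hab _)
    have h2 := mul_le_mul_of_nonneg_left ih hb
    have h3 := mul_le_mul_of_nonneg_right hab h0
    push_cast
    calc (n + 1 + 1) * b ^ (n + 1) * (a - b)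
        = b * ((n + 1) * b ^ n * (a - b)) + b ^ (n + 1) * (a - b) := by ring
      _ ≤ a * (a ^ (n + 1) - b ^ (n + 1)) + b ^ (n + 1) * (a - b) := by linarith
      _ = _ := by ring

/-- This compares a Riemann sum of `t^d` with its integral over `[0, w + n m]`: as a sum over right
endpoints it dominates the integral because `w ≤ m`, and without its last term it is a sum over left
endpoints. -/
lemma sum_arithmetic_pow_bounds {w m : ℝ} (hw : 0 ≤ w) (hwm : w ≤ m) (d n : ℕ) :
    (w + n * m) ^ (d + 1) / (d + 1) ≤ m * ∑ i ∈ Finset.range (n + 1), (w + i * m) ^ d ∧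
    m * ∑ i ∈ Finset.range (n + 1), (w + i * m) ^ d ≤
      (w + n * m) ^ (d + 1) / (d + 1) + m * (w + n * m) ^ d := by
  have hm : 0 ≤ m := hw.trans hwm
  have hd : (0 : ℝ) < d + 1 := by positivity
  induction n with
  | zero =>
    simp only [Nat.cast_zero, zero_mul, add_zero, zero_add, Finset.sum_range_one]
    refine ⟨?_, ?_⟩
    · rw [div_le_iff₀ hd, pow_succ]
      have h1 : w ^ d * w ≤ w ^ d * m := mul_le_mul_of_nonneg_left hwm (by positivity)
      have h2 : (0 : ℝ) ≤ m * w ^ d * d := by positivity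
      nlinarith
    · have : 0 ≤ w ^ (d + 1) / (d + 1) := by positivity
      linarith
  | succ n ih =>
    rw [Finset.sum_range_succ, mul_add]
    have hz : 0 ≤ w + n * m := by positivity
    have hz' : w + n * m ≤ w + (n + 1 : ℕ) * m := by push_cast; linarith
    have e : w + (n + 1 : ℕ) * m - (w + n * m) = m := by push_cast; ring
    have h1 := pow_succ_sub_pow_succ_le hz hz' d
    have h2 := le_pow_succ_sub_pow_succ hz hz' d
    rw [e] at h1 h2
    generalize w + (n + 1 : ℕ) * m = Z at *
    generalize w + n * m = z at *
    have h1' : Z ^ (d + 1) / (d + 1) ≤ z ^ (d + 1) / (d + 1) + m * Z ^ d := by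
      rw [div_le_iff₀ hd, add_mul, div_mul_cancel₀ _ hd.ne']; linarith
    have h2' : z ^ (d + 1) / (d + 1) + m * z ^ d ≤ Z ^ (d + 1) / (d + 1) := by
      rw [le_div_iff₀ hd, add_mul, div_mul_cancel₀ _ hd.ne']; linarith
    constructor <;> linarith [ih.1, ih.2]

/-- The progression has spacing `m` and starts at most `m` above 0, so the sum is a Riemann sum for
the integral of `(r - t)^d`, off by at most one term. The case `u = m` is allowed because the
negative half-line needs it. -/
lemma abs_sum_arithmetic_sub_le {r : ℝ} (hr : 0 ≤ r) {m : ℕ} (hm : 0 < m) {u : ℤ} (hu : 0 ≤ u)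
    (hum : u ≤ m) (Y : Finset ℤ)
    (hY : ∀ y : ℤ, y ∈ Y ↔ u ≤ y ∧ (y : ℝ) ≤ r ∧ (m : ℤ) ∣ y - u) (d : ℕ) :
    |∑ y ∈ Y, (r - y) ^ d - r ^ (d + 1) / ((d + 1) * m)| ≤ r ^ d := by
  have hmR : (0 : ℝ) < m := by exact_mod_cast hm
  have huR : (0 : ℝ) ≤ u := by exact_mod_cast hu
  have humR : (u : ℝ) ≤ m := by exact_mod_cast hum
  have hd : (0 : ℝ) < d + 1 := by positivity
  rcases lt_or_ge r u with h | h
  · have hYe : Y = ∅ := by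
      ext y
      simp only [hY, Finset.notMem_empty, iff_false, not_and]
      intro h1 h2
      have : (u : ℝ) ≤ y := by exact_mod_cast h1
      linarith
    rw [hYe, Finset.sum_empty, zero_sub, abs_neg, abs_of_nonneg (by positivity),
      div_le_iff₀ (by positivity), pow_succ]
    have h1 : r ^ d * r ≤ r ^ d * m := mul_le_mul_of_nonneg_left (h.le.trans humR) (by positivity)
    have h2 : (0 : ℝ) ≤ r ^ d * m * d := by positivity
    nlinarith
  · set n := ⌊(r - u) / m⌋₊ with hn
    set w := r - u - n * m with hw
    have hq : 0 ≤ (r - u) / m := div_nonneg (by linarith) hmR.le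
    have hn1 : n * (m : ℝ) ≤ r - u := (le_div_iff₀ hmR).1 (Nat.floor_le hq)
    have hn2 : r - u < (n + 1) * m := (div_lt_iff₀ hmR).1 (Nat.lt_floor_add_one _)
    have hsum : ∑ y ∈ Y, (r - y) ^ d = ∑ i ∈ Finset.range (n + 1), (w + i * m) ^ d := by
      symm
      -- Counting from the largest point downwards makes `r - y` run through `w + i m` with `0 ≤ w <
      -- m`.
      refine Finset.sum_bij (fun i _ => u + ((n : ℤ) - i) * m) ?_ ?_ ?_ ?_
      · intro i hi
        have hi' : (i : ℤ) ≤ n := by have := Finset.mem_range.1 hi; omega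
        rw [hY]
        refine ⟨?_, ?_, ?_⟩
        · nlinarith
        · push_cast
          have : (0 : ℝ) ≤ i * m := by positivity
          nlinarith
        · simp
      · intro i _ j _ hij
        have hm0 : (m : ℤ) ≠ 0 := by exact_mod_cast hm.ne'
        have h1 := mul_right_cancel₀ hm0 (add_left_cancel hij)
        have : (i : ℤ) = j := by linarith
        exact_mod_cast this
      · intro y hy
        obtain ⟨h1, h2, q, h3⟩ := (hY y).1 hy
        have hmZ : (0 : ℤ) < m := by exact_mod_cast hm
        have hq0 : 0 ≤ q := by
          by_contra hneg
          have : q ≤ -1 := by omega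
          nlinarith
        have hqn : q ≤ n := by
          have h4 : (y : ℝ) - u = m * q := by exact_mod_cast h3
          have h5 : (q : ℝ) * m < (n + 1) * m := by nlinarith
          have h6 : (q : ℝ) < n + 1 := lt_of_mul_lt_mul_right h5 hmR.le
          have h7 : q < n + 1 := by exact_mod_cast h6
          omega
        refine ⟨(n - q).toNat, Finset.mem_range.2 (by omega), ?_⟩
        have : (((n : ℤ) - q).toNat : ℤ) = n - q := Int.toNat_of_nonneg (by omega)
        rw [this]
        linarith
      · intro i _
        congr 1
        push_cast
        rw [hw]; ring
    rw [hsum]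
    obtain ⟨b1, b2⟩ := sum_arithmetic_pow_bounds (w := w) (m := m) (by rw [hw]; linarith)
      (by rw [hw]; nlinarith) d n
    have hwn : w + n * m = r - u := by rw [hw]; ring
    rw [hwn] at b1 b2
    have hru : 0 ≤ r - u := by linarith
    have hle : r - u ≤ r := by linarith
    have c1 := pow_succ_sub_pow_succ_le hru hle d
    have c2 : (r - u) ^ (d + 1) ≤ r ^ (d + 1) := pow_le_pow_left₀ hru hle _
    have c3 : (r - u) ^ d ≤ r ^ d := pow_le_pow_left₀ hru hle _
    set T := ∑ i ∈ Finset.range (n + 1), (w + i * m) ^ d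
    have e : T - r ^ (d + 1) / ((d + 1) * m) = (m * T - r ^ (d + 1) / (d + 1)) / m := by
      field_simp
    rw [e, abs_div, abs_of_pos hmR, div_le_iff₀ hmR, abs_le]
    have c1' : r ^ (d + 1) / (d + 1) ≤ (r - u) ^ (d + 1) / (d + 1) + u * r ^ d := by
      rw [div_le_iff₀ hd, add_mul, div_mul_cancel₀ _ hd.ne']; linarith
    have c2' : (r - u) ^ (d + 1) / (d + 1) ≤ r ^ (d + 1) / (d + 1) := by gcongr
    have c4 : (u : ℝ) * r ^ d ≤ m * r ^ d := by gcongr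
    have c5 : (m : ℝ) * (r - u) ^ d ≤ m * r ^ d := by gcongr
    constructor <;> linarith

lemma abs_sum_two_sided_sub_le {r : ℝ} (hr : 0 ≤ r) {m : ℕ} (hm : 0 < m) (t : ℤ) (d : ℕ) :
    |∑ y ∈ Finset.Icc (-⌊r⌋) ⌊r⌋ with (m : ℤ) ∣ y - t, (r - |(y : ℝ)|) ^ d
      - 2 * r ^ (d + 1) / ((d + 1) * m)| ≤ 2 * r ^ d := by
  classical
  have hmZ : (0 : ℤ) < m := by exact_mod_cast hm
  set Y := {y ∈ Finset.Icc (-⌊r⌋) ⌊r⌋ | (m : ℤ) ∣ y - t} with hYdef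
  set Y1 := {y ∈ Y | 0 ≤ y}
  set Y2 := {y ∈ Y | ¬ 0 ≤ y}
  have hfl : ∀ y : ℤ, (y : ℝ) ≤ r ↔ y ≤ ⌊r⌋ := fun y => Int.le_floor.symm
  have hr0 : 0 ≤ ⌊r⌋ := Int.floor_nonneg.2 hr
  have hsplit : ∑ y ∈ Y, (r - |(y : ℝ)|) ^ d =
      ∑ y ∈ Y1, (r - y) ^ d + ∑ y ∈ Y2.image (fun y => -y), (r - y) ^ d := by
    rw [← Finset.sum_filter_add_sum_filter_not Y (fun y => 0 ≤ y)]
    congr 1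
    · refine Finset.sum_congr rfl fun y hy => ?_
      have : (0 : ℝ) ≤ y := by exact_mod_cast (Finset.mem_filter.1 hy).2
      rw [abs_of_nonneg this]
    · rw [Finset.sum_image (by intro a _ b _ h; simpa using h)]
      refine Finset.sum_congr rfl fun y hy => ?_
      have h0 : y < 0 := not_le.1 (Finset.mem_filter.1 hy).2
      have : (y : ℝ) < 0 := by exact_mod_cast h0
      rw [abs_of_neg this]; push_cast; ring
  have key : ∀ a u : ℤ, (m : ℤ) ∣ u - a → ∀ y, ((m : ℤ) ∣ y - a ↔ (m : ℤ) ∣ y - u) := by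
    intro a u h y
    have : y - a = (y - u) + (u - a) := by ring
    rw [this]
    exact (dvd_add_left h)
  have h1 := abs_sum_arithmetic_sub_le hr hm (u := t % m) (Int.emod_nonneg _ hmZ.ne')
    (Int.emod_lt_of_pos _ hmZ).le Y1 (by
      intro y
      have hdv := key t (t % m) (Int.ModEq.dvd (Int.mod_modEq t m).symm) y
      simp only [Y1, hYdef, Finset.mem_filter, Finset.mem_Icc, hfl, hdv]
      constructor
      · rintro ⟨⟨⟨_, h2⟩, h3⟩, h4⟩
        refine ⟨?_, h2, h3⟩
        obtain ⟨q, hq⟩ := h3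
        have := Int.emod_lt_of_pos t hmZ
        by_contra hlt
        have : q ≤ -1 := by
          by_contra hq'
          have : 0 ≤ q := by omega
          nlinarith
        nlinarith
      · rintro ⟨h2, h3, h4⟩
        have := Int.emod_nonneg t hmZ.ne'
        exact ⟨⟨⟨by omega, h3⟩, h4⟩, by omega⟩) d
  -- This representative of `-t` lies in `[1, m]` rather than `[0, m)`, so that `y = 0` is counted
  -- only in the nonnegative half.
  have h2 := abs_sum_arithmetic_sub_le hr hm (u := (-t - 1) % m + 1)
    (by have := Int.emod_nonneg (-t - 1) hmZ.ne'; omega)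
    (by have := Int.emod_lt_of_pos (-t - 1) hmZ; omega) (Y2.image (fun y => -y)) (by
      intro y
      have hdv := key (-t) ((-t - 1) % m + 1) (by
        have := Int.ModEq.dvd (Int.mod_modEq (-t - 1) m).symm
        have e : (-t - 1) % m + 1 - -t = (-t - 1) % m - (-t - 1) := by ring
        rwa [e]) y
      have hdv' : ((m : ℤ) ∣ -y - t ↔ (m : ℤ) ∣ y - -t) := by
        rw [← dvd_neg]; ring_nf
      have hmem : y ∈ Y2.image (fun y => -y) ↔ -y ∈ Y2 := by
        simp only [Finset.mem_image]
        constructor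
        · rintro ⟨z, hz, rfl⟩; simpa using hz
        · intro h; exact ⟨-y, h, by simp⟩
      rw [hmem]
      simp only [Y2, hYdef, Finset.mem_filter, Finset.mem_Icc, hfl, hdv', hdv]
      have g1 := Int.emod_nonneg (-t - 1) hmZ.ne'
      have g2 := Int.emod_lt_of_pos (-t - 1) hmZ
      constructor
      · rintro ⟨⟨⟨h1, h2⟩, h3⟩, h4⟩
        refine ⟨?_, by omega, h3⟩
        obtain ⟨q, hq⟩ := h3
        by_contra hlt
        have : q ≤ -1 := by
          by_contra hq'
          have : 0 ≤ q := by omega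
          nlinarith
        nlinarith
      · rintro ⟨h2, h3, h4⟩
        exact ⟨⟨⟨by omega, by omega⟩, h4⟩, by omega⟩) d
  rw [hsplit]
  have e : 2 * r ^ (d + 1) / ((d + 1) * m) =
      r ^ (d + 1) / ((d + 1) * m) + r ^ (d + 1) / ((d + 1) * m) := by ring
  rw [e]
  have := abs_add_le (∑ y ∈ Y1, (r - y) ^ d - r ^ (d + 1) / ((d + 1) * m))
    (∑ y ∈ Y2.image (fun y => -y), (r - y) ^ d - r ^ (d + 1) / ((d + 1) * m))
  rw [add_sub_add_comm]
  linarith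

/-- The points of the coset `t + L` in the `ℓ¹` ball of radius `r`. -/
def cosetBall {d : ℕ} (L : AddSubgroup (Fin d → ℤ)) (t : Fin d → ℤ) (r : ℝ) :
    Set (Fin d → ℤ) :=
  {v | v - t ∈ L ∧ ((∑ j, |v j| : ℤ) : ℝ) ≤ r}

lemma finite_cosetBall {d : ℕ} (L : AddSubgroup (Fin d → ℤ)) (t : Fin d → ℤ) (r : ℝ) :
    (cosetBall L t r).Finite := by
  have hfin : (Set.pi Set.univ fun _ : Fin d => Set.Icc (-⌊r⌋) ⌊r⌋).Finite :=
    Set.Finite.pi fun _ => Set.finite_Icc _ _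
  refine hfin.subset fun v hv j _ => ?_
  have h1 : ∑ j, |v j| ≤ ⌊r⌋ := Int.le_floor.mpr hv.2
  have h2 : |v j| ≤ ∑ j, |v j| :=
    Finset.single_le_sum (f := fun j => |v j|) (fun _ _ => abs_nonneg _) (Finset.mem_univ j)
  exact abs_le.mp (h2.trans h1)

/-- The inclusion of `ℤ^d` into `ℤ^(d+1)` as the kernel of the first coordinate. -/
def consZero (d : ℕ) : (Fin d → ℤ) →+ (Fin (d + 1) → ℤ) where
  toFun w := Fin.cons 0 w
  map_zero' := by ext j; refine Fin.cases ?_ ?_ j <;> simp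
  map_add' v w := by ext j; refine Fin.cases ?_ ?_ j <;> simp

/-- The kernel of the first coordinate is the image of `consZero`, so `ℤ^(d+1)/L` is an extension of
the quotient by the projection of `L` by the quotient of that kernel by its intersection with `L`.
-/
lemma index_eq_index_map_mul_index_comap {d : ℕ} (L : AddSubgroup (Fin (d + 1) → ℤ)) :
    L.index = (L.map (Pi.evalAddMonoidHom (fun _ => ℤ) (0 : Fin (d + 1)))).index *
      (L.comap (consZero d)).index := by
  have hker : (Pi.evalAddMonoidHom (fun _ => ℤ) (0 : Fin (d + 1))).ker = (consZero d).range := by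
    ext v
    simp only [AddMonoidHom.mem_ker, Pi.evalAddMonoidHom_apply, AddMonoidHom.mem_range]
    constructor
    · intro h
      exact ⟨Fin.tail v, by rw [← Fin.cons_self_tail v, h]; rfl⟩
    · rintro ⟨w, rfl⟩; rfl
  have hsurj : (Pi.evalAddMonoidHom (fun _ => ℤ) (0 : Fin (d + 1))).range = ⊤ :=
    AddMonoidHom.range_eq_top.2 fun y => ⟨fun _ => y, rfl⟩
  rw [AddSubgroup.index_map, hsurj, AddSubgroup.index_top, mul_one, AddSubgroup.index_comap, hker,
    mul_comm, ← AddSubgroup.relIndex_sup_right, sup_comm,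
    AddSubgroup.relIndex_mul_index le_sup_left]

lemma ncard_cosetBall_succ {d : ℕ} (L : AddSubgroup (Fin (d + 1) → ℤ)) (t : Fin (d + 1) → ℤ)
    (r : ℝ) :
    (cosetBall L t r).ncard = ∑ y ∈ Finset.Icc (-⌊r⌋) ⌊r⌋,
      {w : Fin d → ℤ | (Fin.cons y w : Fin (d + 1) → ℤ) ∈ cosetBall L t r}.ncard := by
  classical
  rw [Set.ncard_eq_toFinset_card _ (finite_cosetBall L t r),
    Finset.card_eq_sum_card_fiberwise (f := fun v => v 0) (t := Finset.Icc (-⌊r⌋) ⌊r⌋)]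
  · refine Finset.sum_congr rfl fun y _ => ?_
    rw [← Set.ncard_coe_finset, ← Set.ncard_image_of_injective
      {w : Fin d → ℤ | (Fin.cons y w : Fin (d + 1) → ℤ) ∈ cosetBall L t r}
      (Fin.cons_right_injective (α := fun _ => ℤ) y)]
    congr 1
    ext v
    simp only [Finset.coe_filter, Set.Finite.mem_toFinset, Set.mem_ofPred_eq, Set.mem_image]
    constructor
    · rintro ⟨h1, rfl⟩
      exact ⟨Fin.tail v, by rwa [Fin.cons_self_tail], Fin.cons_self_tail v⟩
    · rintro ⟨w, h1, rfl⟩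
      exact ⟨h1, rfl⟩
  · intro v hv
    have hv' := (Set.Finite.mem_toFinset _).1 hv
    have h1 : ∑ j, |v j| ≤ ⌊r⌋ := Int.le_floor.mpr hv'.2
    have h2 : |v 0| ≤ ∑ j, |v j| :=
      Finset.single_le_sum (f := fun j => |v j|) (fun _ _ => abs_nonneg _) (Finset.mem_univ 0)
    simpa using abs_le.mp (h2.trans h1)

/-- Induction on `d` by slicing along the first coordinate: if `L` projects onto `mℤ`, the slice at
`y` is empty unless `y ≡ t 0 mod m`, and otherwise is a coset ball of radius `ρ - |y|` for `L'`. The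
factor `1 + r` on the left stands for the exponent `d - 1` without a special case at `d = 0`; the
second radius `r` gives all slices the same error bound. -/
lemma exists_index_cosetBall (d : ℕ) : ∃ C : ℝ, 0 ≤ C ∧ ∀ L : AddSubgroup (Fin d → ℤ),
    L.index ≠ 0 → ∀ (t : Fin d → ℤ) (ρ r : ℝ), 0 ≤ ρ → ρ ≤ r →
      |((cosetBall L t ρ).ncard : ℝ) - 2 ^ d / d.factorial * ρ ^ d / L.index| * (1 + r) ≤
        C * (1 + r) ^ d := by
  classical
  induction d with
  | zero =>
    refine ⟨0, le_rfl, fun L hL t ρ r h0 hr => ?_⟩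
    have hL : L = ⊤ := Subsingleton.elim _ _
    have : cosetBall L t ρ = Set.univ := by
      ext v; simp [cosetBall, hL, h0]
    rw [this, hL]
    simp
  | succ d ih =>
    obtain ⟨C, hC, ih⟩ := ih
    -- The term `3 * C` collects the errors of at most `2ρ + 1` slices; the other term is the error
    -- in summing their main terms.
    refine ⟨3 * C + 2 * (2 ^ d / d.factorial), by positivity, fun L hL t ρ r h0 hr => ?_⟩
    set π := Pi.evalAddMonoidHom (fun _ => ℤ) (0 : Fin (d + 1))
    set L' := L.comap (consZero d) with hL'
    obtain ⟨g, hg⟩ := Int.subgroup_cyclic (L.map π)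
    have hg' : L.map π = AddSubgroup.zmultiples g := by
      rw [hg, AddSubgroup.zmultiples_eq_closure]
    set m := g.natAbs with hm
    have hidx : L.index = m * L'.index := by
      rw [index_eq_index_map_mul_index_comap, hg', Int.index_zmultiples]
    have hm0 : m ≠ 0 := by rintro h; simp [hidx, h] at hL
    have hL0 : L'.index ≠ 0 := by rintro h; simp [hidx, h] at hL
    have hmpos : 0 < m := Nat.pos_of_ne_zero hm0
    have hr0 : 0 ≤ r := h0.trans hr
    have hN : (0 : ℝ) < L'.index := by exact_mod_cast Nat.pos_of_ne_zero hL0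
    have hmR : (0 : ℝ) < m := by exact_mod_cast hmpos
    set V : ℝ := 2 ^ d / d.factorial with hV
    have hVpos : 0 ≤ V := by positivity
    have hπ : ∀ y, y ∈ L.map π ↔ (m : ℤ) ∣ y := by
      intro y
      rw [hg', Int.mem_zmultiples_iff, hm, Int.natAbs_dvd]
    have hslice : ∀ y : ℤ, y ∈ Finset.Icc (-⌊ρ⌋) ⌊ρ⌋ →
        if (m : ℤ) ∣ y - t 0 then
          |({w : Fin d → ℤ | (Fin.cons y w : Fin (d + 1) → ℤ) ∈ cosetBall L t ρ}.ncard : ℝ)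
            - V * (ρ - |(y : ℝ)|) ^ d / L'.index| * (1 + r) ≤ C * (1 + r) ^ d
        else
          {w : Fin d → ℤ | (Fin.cons y w : Fin (d + 1) → ℤ) ∈ cosetBall L t ρ}.ncard = 0 := by
      intro y hy
      have hyρ : |(y : ℝ)| ≤ ρ := by
        have h1 : |y| ≤ ⌊ρ⌋ := abs_le.2 (Finset.mem_Icc.1 hy)
        have := Int.le_floor.1 h1
        exact_mod_cast this
      split_ifs with hdvd
      · obtain ⟨v, hv, hvy⟩ := (hπ _).2 hdvd
        have hset : {w : Fin d → ℤ | (Fin.cons y w : Fin (d + 1) → ℤ) ∈ cosetBall L t ρ} =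
            cosetBall L' (Fin.tail t + Fin.tail v) (ρ - |(y : ℝ)|) := by
          ext w
          have hdec : (Fin.cons y w : Fin (d + 1) → ℤ) - t =
              consZero d (w - (Fin.tail t + Fin.tail v)) + v := by
            ext j
            refine Fin.cases ?_ (fun j => ?_) j
            · have : v 0 = y - t 0 := hvy
              simp [consZero, this]
            · simp only [consZero, Fin.tail, Pi.sub_apply, Pi.add_apply, Fin.cons_succ,
                AddMonoidHom.coe_mk, ZeroHom.coe_mk]
              ring
          have hmem : (Fin.cons y w : Fin (d + 1) → ℤ) - t ∈ L ↔
              w - (Fin.tail t + Fin.tail v) ∈ L' := by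
            rw [hdec, AddSubgroup.add_mem_cancel_right _ hv, hL', AddSubgroup.mem_comap]
          simp only [cosetBall, Set.mem_ofPred_eq, hmem, Fin.sum_univ_succ, Fin.cons_zero,
            Fin.cons_succ]
          push_cast
          exact and_congr_right fun _ => le_sub_iff_add_le'.symm
        rw [hset]
        exact ih L' hL0 _ _ _ (by linarith) (by linarith [abs_nonneg (y : ℝ)])
      · convert Set.ncard_empty (Fin d → ℤ)
        rw [Set.eq_empty_iff_forall_notMem]
        intro w hw
        exact hdvd ((hπ _).1 ⟨_, hw.1, by simp [π]⟩)
    have hcount : ((cosetBall L t ρ).ncard : ℝ) =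
        ∑ y ∈ Finset.Icc (-⌊ρ⌋) ⌊ρ⌋ with (m : ℤ) ∣ y - t 0,
          ({w : Fin d → ℤ | (Fin.cons y w : Fin (d + 1) → ℤ) ∈ cosetBall L t ρ}.ncard : ℝ) := by
      rw [ncard_cosetBall_succ, Finset.sum_filter]
      push_cast
      refine Finset.sum_congr rfl fun y hy => ?_
      have := hslice y hy
      split_ifs with h
      · rfl
      · rw [if_neg h] at this; exact_mod_cast this
    have hmain := abs_sum_two_sided_sub_le h0 hmpos (t 0) d
    set Y := {y ∈ Finset.Icc (-⌊ρ⌋) ⌊ρ⌋ | (m : ℤ) ∣ y - t 0} with hY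
    have hYcard : (Y.card : ℝ) ≤ 3 * (1 + r) := by
      have h1 : Y.card ≤ (Finset.Icc (-⌊ρ⌋) ⌊ρ⌋).card := Finset.card_filter_le _ _
      rw [Int.card_Icc] at h1
      have hfl : 0 ≤ ⌊ρ⌋ := Int.floor_nonneg.2 h0
      have h2 : (Y.card : ℤ) ≤ 2 * ⌊ρ⌋ + 1 := by omega
      have h3 : (Y.card : ℝ) ≤ 2 * ⌊ρ⌋ + 1 := by exact_mod_cast h2
      linarith [Int.floor_le ρ]
    have hdiff : |((cosetBall L t ρ).ncard : ℝ) -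
        ∑ y ∈ Y, V * (ρ - |(y : ℝ)|) ^ d / L'.index| * (1 + r) ≤
          Y.card * (C * (1 + r) ^ d) := by
      rw [hcount, ← Finset.sum_sub_distrib]
      calc _ ≤ (∑ y ∈ Y, |({w : Fin d → ℤ | (Fin.cons y w : Fin (d + 1) → ℤ) ∈
              cosetBall L t ρ}.ncard : ℝ) - V * (ρ - |(y : ℝ)|) ^ d / L'.index|) * (1 + r) := by
            gcongr; exact Finset.abs_sum_le_sum_abs _ _
        _ ≤ ∑ y ∈ Y, C * (1 + r) ^ d := by
            rw [Finset.sum_mul]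
            refine Finset.sum_le_sum fun y hy => ?_
            have h1 := hslice y (Finset.mem_filter.1 hy).1
            rwa [if_pos (Finset.mem_filter.1 hy).2] at h1
        _ = _ := by rw [Finset.sum_const, nsmul_eq_mul]
    have hdiff2 : |∑ y ∈ Y, V * (ρ - |(y : ℝ)|) ^ d / L'.index -
        2 ^ (d + 1) / (d + 1).factorial * ρ ^ (d + 1) / L.index| ≤ V * (2 * (1 + r) ^ d) := by
      have e : ∑ y ∈ Y, V * (ρ - |(y : ℝ)|) ^ d / L'.index -
          2 ^ (d + 1) / (d + 1).factorial * ρ ^ (d + 1) / L.index =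
          V / L'.index * (∑ y ∈ Y, (ρ - |(y : ℝ)|) ^ d - 2 * ρ ^ (d + 1) / ((d + 1) * m)) := by
        rw [mul_sub, Finset.mul_sum]
        congr 1
        · exact Finset.sum_congr rfl fun y _ => by ring
        · rw [hidx, hV, Nat.factorial_succ]
          push_cast
          field_simp
          ring
      rw [e, abs_mul, abs_of_nonneg (by positivity)]
      have h1 : V / L'.index ≤ V := div_le_self hVpos (by exact_mod_cast Nat.pos_of_ne_zero hL0)
      have h2 : ρ ^ d ≤ (1 + r) ^ d := pow_le_pow_left₀ h0 (by linarith) d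
      calc _ ≤ V * (2 * ρ ^ d) := by gcongr
        _ ≤ _ := by gcongr
    have htri := abs_sub_le ((cosetBall L t ρ).ncard : ℝ)
      (∑ y ∈ Y, V * (ρ - |(y : ℝ)|) ^ d / L'.index)
      (2 ^ (d + 1) / (d + 1).factorial * ρ ^ (d + 1) / L.index)
    have h1r : 0 ≤ 1 + r := by linarith
    have hYC : Y.card * (C * (1 + r) ^ d) ≤ 3 * (1 + r) * (C * (1 + r) ^ d) := by gcongr
    calc _ ≤ (|((cosetBall L t ρ).ncard : ℝ) -
        ∑ y ∈ Y, V * (ρ - |(y : ℝ)|) ^ d / L'.index| + |∑ y ∈ Y, V * (ρ - |(y : ℝ)|) ^ d / L'.index -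
        2 ^ (d + 1) / (d + 1).factorial * ρ ^ (d + 1) / L.index|) * (1 + r) := by gcongr
      _ ≤ 3 * (1 + r) * (C * (1 + r) ^ d) + V * (2 * (1 + r) ^ d) * (1 + r) := by
          rw [add_mul]
          exact add_le_add (hdiff.trans hYC) (mul_le_mul_of_nonneg_right hdiff2 h1r)
      _ = _ := by rw [pow_succ]; ring

/-! ### The geometric norm on the ring of integers -/

section GeomNorm

variable {K : Type*} [Field K] {d : ℕ} (e : Module.Basis (Fin d) ℤ (𝓞 K))

lemma geomNorm_nonneg (a : 𝓞 K) : 0 ≤ geomNorm e a :=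
  Finset.sum_nonneg fun _ _ => abs_nonneg _

lemma geomNorm_add_le (a b : 𝓞 K) : geomNorm e (a + b) ≤ geomNorm e a + geomNorm e b := by
  simp only [geomNorm, map_add, Finsupp.add_apply, ← Finset.sum_add_distrib]
  exact Finset.sum_le_sum fun _ _ => abs_add_le _ _

variable [NumberField K]

/-- The elements of the coset `t + I` in the ball of radius `x`. -/
def idealBall (I : Ideal (𝓞 K)) (t : 𝓞 K) (x : ℝ) : Set (𝓞 K) :=
  {c | c - t ∈ I ∧ c ∈ ball e x}

lemma absNorm_pos {I : Ideal (𝓞 K)} (hI : I ≠ ⊥) : 0 < Ideal.absNorm I :=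
  Nat.pos_of_ne_zero fun h => hI (Ideal.absNorm_eq_zero_iff.1 h)

lemma exists_ncard_idealBall : ∃ C : ℝ, 0 ≤ C ∧ ∀ I : Ideal (𝓞 K), I ≠ ⊥ →
    ∀ (t : 𝓞 K) (x : ℝ), 1 ≤ x →
      |((idealBall e I t x).ncard : ℝ) - 2 ^ d / d.factorial * x ^ d / Ideal.absNorm I| * x ≤
        C * x ^ d := by
  obtain ⟨C, hC, h⟩ := exists_index_cosetBall d
  refine ⟨C * 2 ^ d, by positivity, fun I hI t x hx => ?_⟩
  let φ : 𝓞 K ≃+ (Fin d → ℤ) := e.equivFun.toAddEquiv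
  let L : AddSubgroup (Fin d → ℤ) := I.toAddSubgroup.map (φ : 𝓞 K →+ (Fin d → ℤ))
  have hidx : L.index = Ideal.absNorm I := by
    rw [AddSubgroup.index_map_of_bijective φ.bijective]
    rfl
  have hcard : (idealBall e I t x).ncard = (cosetBall L (φ t) x).ncard := by
    rw [← Set.ncard_image_of_injective _ φ.injective]
    congr 1
    ext v
    obtain ⟨c, rfl⟩ := φ.surjective v
    rw [Set.mem_image_iff_of_inverse φ.symm_apply_apply φ.apply_symm_apply, φ.symm_apply_apply]
    simp only [idealBall, cosetBall, Set.mem_ofPred_eq]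
    refine and_congr ?_ Iff.rfl
    rw [← map_sub]
    exact (AddSubgroup.mem_map_iff_mem (f := (φ : 𝓞 K →+ (Fin d → ℤ))) (K := I.toAddSubgroup)
      φ.injective).symm
  have h1 := h L (by rw [hidx]; exact (absNorm_pos hI).ne') (φ t) x x (by linarith) le_rfl
  rw [← hcard, hidx] at h1
  have h2 : (1 + x) ^ d ≤ 2 ^ d * x ^ d := by
    rw [← mul_pow]; exact pow_le_pow_left₀ (by linarith) (by linarith) _
  calc _ ≤ _ := mul_le_mul_of_nonneg_left (by linarith : x ≤ 1 + x) (abs_nonneg _)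
    _ ≤ _ := h1
    _ ≤ C * (2 ^ d * x ^ d) := by gcongr
    _ = _ := by ring

lemma exists_ncard_ball : ∃ C : ℝ, 0 ≤ C ∧ ∀ x : ℝ, 1 ≤ x →
    ((ball e x).ncard : ℝ) ≤ C * x ^ d := by
  obtain ⟨C, hC, h⟩ := exists_ncard_idealBall e
  refine ⟨C + 2 ^ d / d.factorial, by positivity, fun x hx => ?_⟩
  have h1 := h ⊤ top_ne_bot 0 x hx
  have h2 : idealBall e ⊤ 0 x = ball e x := by ext c; simp [idealBall]
  rw [h2, Ideal.absNorm_top, Nat.cast_one, div_one] at h1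
  have h3 : |((ball e x).ncard : ℝ) - 2 ^ d / d.factorial * x ^ d| ≤ C * x ^ d :=
    (le_mul_of_one_le_right (abs_nonneg _) hx).trans h1
  have := (abs_le.1 h3).2
  linarith

lemma finrank_eq_of_basis {K : Type*} [Field K] [NumberField K] {d : ℕ}
    (e : Module.Basis (Fin d) ℤ (𝓞 K)) : Module.finrank ℚ K = d := by
  rw [← RingOfIntegers.rank, Module.finrank_eq_card_basis e, Fintype.card_fin]

/-- The norm is the product of the `d` complex embeddings, each bounded by a multiple of the
geometric norm. -/
lemma exists_norm_le : ∃ C : ℝ, 0 < C ∧ ∀ c : 𝓞 K,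
    |(Algebra.norm ℤ c : ℝ)| ≤ C * (geomNorm e c : ℝ) ^ d := by
  obtain ⟨B, hB⟩ : ∃ B : ℝ, ∀ (σ : K →ₐ[ℚ] ℂ) (j : Fin d), ‖σ (e j : K)‖ ≤ B := by
    obtain ⟨B, hB⟩ := (Set.finite_range fun p : (K →ₐ[ℚ] ℂ) × Fin d => ‖p.1 (e p.2 : K)‖).bddAbove
    exact ⟨B, fun σ j => hB ⟨(σ, j), rfl⟩⟩
  set B' := max B 1
  have hB' : 0 < B' := lt_max_of_lt_right one_pos
  refine ⟨B' ^ d, by positivity, fun c => ?_⟩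
  have h1 : ∀ σ : K →ₐ[ℚ] ℂ, ‖σ (c : K)‖ ≤ B' * geomNorm e c := by
    intro σ
    have h2 : (c : K) = ∑ j, (e.repr c j : K) * (e j : K) := by
      conv_lhs => rw [← e.sum_repr c]
      simp
    rw [h2, map_sum, geomNorm]
    push_cast
    rw [Finset.mul_sum]
    refine (norm_sum_le _ _).trans (Finset.sum_le_sum fun j _ => ?_)
    rw [map_mul, norm_mul, map_intCast, Complex.norm_intCast, mul_comm]
    gcongr
    exact (hB σ j).trans (le_max_left _ _)
  have h3 : ((Algebra.norm ℤ c : ℝ) : ℂ) = ∏ σ : K →ₐ[ℚ] ℂ, σ (c : K) := by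
    rw [← Algebra.norm_eq_prod_embeddings ℚ ℂ, ← Algebra.coe_norm_int]
    simp
  rw [← Real.norm_eq_abs, ← Complex.norm_real, h3, norm_prod]
  calc _ ≤ ∏ _σ : K →ₐ[ℚ] ℂ, B' * (geomNorm e c : ℝ) :=
        Finset.prod_le_prod (fun _ _ => norm_nonneg _) fun σ _ => h1 σ
    _ = _ := by
        rw [Finset.prod_const, Finset.card_univ, AlgHom.card, finrank_eq_of_basis e, mul_pow]

lemma exists_absNorm_le : ∃ C : ℝ, 0 < C ∧ ∀ (I : Ideal (𝓞 K)) (c : 𝓞 K), c ∈ I → c ≠ 0 →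
    (Ideal.absNorm I : ℝ) ≤ C * (geomNorm e c : ℝ) ^ d := by
  obtain ⟨C, hC, h⟩ := exists_norm_le e
  refine ⟨C, hC, fun I c hc hc0 => ?_⟩
  have h1 : (Ideal.absNorm I : ℤ) ∣ Algebra.norm ℤ c := Ideal.absNorm_dvd_norm_of_mem hc
  have h2 : Algebra.norm ℤ c ≠ 0 := Algebra.norm_ne_zero_iff.2 hc0
  have h3 : (Ideal.absNorm I : ℤ) ≤ |Algebra.norm ℤ c| :=
    Int.le_of_dvd (abs_pos.2 h2) ((dvd_abs _ _).2 h1)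
  have h4 : (Ideal.absNorm I : ℝ) ≤ |(Algebra.norm ℤ c : ℝ)| := by exact_mod_cast h3
  exact h4.trans (h c)

/-- Few nonzero elements of an ideal are small. -/
lemma exists_ncard_ideal_ne_zero_le : ∃ C : ℝ, 0 ≤ C ∧ ∀ I : Ideal (𝓞 K), I ≠ ⊥ → ∀ x : ℝ, 0 ≤ x →
    ({c : 𝓞 K | c ∈ I ∧ c ≠ 0 ∧ c ∈ ball e x}.ncard : ℝ) ≤ C * x ^ d / Ideal.absNorm I := by
  obtain ⟨C, hC, h⟩ := exists_absNorm_le e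
  have hd : 0 < d := by rw [← finrank_eq_of_basis e]; exact Module.finrank_pos
  have hdR : (1 : ℝ) ≤ d := by exact_mod_cast hd
  refine ⟨6 ^ d * (C * d ^ d), by positivity, fun I hI x hx => ?_⟩
  have hN : (0 : ℝ) < Ideal.absNorm I := by exact_mod_cast absNorm_pos hI
  set A := {c : 𝓞 K | c ∈ I ∧ c ≠ 0 ∧ c ∈ ball e x} with hA
  rcases A.eq_empty_or_nonempty with h0 | ⟨c0, hc0, hc0', hc0x⟩
  · rw [h0, Set.ncard_empty, Nat.cast_zero]; positivity
  -- The box side solves `C (d h')^d = N(I)`: two elements of `I` in one box differ by less than `d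
  -- h'` in geometric norm, too little for a nonzero element of `I`. Each box therefore holds at
  -- most one.
  set h' : ℝ := ((Ideal.absNorm I / C) ^ ((d : ℝ)⁻¹)) / d with hh'
  have hh'pos : 0 < h' := by positivity
  have hpow : C * (d * h') ^ d = Ideal.absNorm I := by
    rw [hh', mul_div_cancel₀ _ (by positivity), Real.rpow_inv_natCast_pow (by positivity) hd.ne']
    field_simp
  have hgn : ∀ c : 𝓞 K, (0 : ℝ) ≤ geomNorm e c := fun c => by exact_mod_cast geomNorm_nonneg e c
  -- The existence of one nonzero element forces `x / h' ≥ 1`, which absorbs the boundary boxes into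
  -- the constant.
  have hhx : h' ≤ x := by
    have h1 : (Ideal.absNorm I : ℝ) ≤ C * x ^ d := (h I c0 hc0 hc0').trans (by
      gcongr
      · exact hgn c0
      · exact hc0x)
    rw [← hpow] at h1
    have h2 := le_of_mul_le_mul_left h1 hC
    have h3 := (pow_le_pow_iff_left₀ (by positivity) hx hd.ne').1 h2
    nlinarith
  let f : 𝓞 K → (Fin d → ℤ) := fun c j => ⌊(e.repr c j : ℝ) / h'⌋
  have hinj : Set.InjOn f A := by
    intro a ha b hb hab
    by_contra hne
    have h1 := h I (a - b) (I.sub_mem ha.1 hb.1) (sub_ne_zero.2 hne)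
    have h2 : (geomNorm e (a - b) : ℝ) < d * h' := by
      rw [geomNorm]
      push_cast
      have : (d : ℝ) * h' = ∑ _j : Fin d, h' := by simp
      rw [this]
      have : Nonempty (Fin d) := ⟨⟨0, hd⟩⟩
      refine Finset.sum_lt_sum_of_nonempty Finset.univ_nonempty fun j _ => ?_
      have h3 := Int.abs_sub_lt_one_of_floor_eq_floor (congrFun hab j)
      rw [← sub_div, abs_div, abs_of_pos hh'pos, div_lt_one hh'pos] at h3
      simpa using h3
    have h3 : (geomNorm e (a - b) : ℝ) ^ d < (d * h') ^ d :=
      pow_lt_pow_left₀ h2 (hgn _) hd.ne'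
    have := mul_lt_mul_of_pos_left h3 hC
    linarith
  set R : ℤ := ⌊x / h'⌋ with hR
  have hR0 : 0 ≤ R := Int.floor_nonneg.2 (by positivity)
  have hmaps : ∀ c ∈ A, f c ∈ (Fintype.piFinset fun _ : Fin d => Finset.Icc (-R - 1) R : Set _) := by
    intro c hc
    simp only [Finset.mem_coe, Fintype.mem_piFinset, Finset.mem_Icc]
    intro j
    have h2 : |e.repr c j| ≤ geomNorm e c :=
      Finset.single_le_sum (f := fun j => |e.repr c j|) (fun _ _ => abs_nonneg _)
        (Finset.mem_univ j)
    have h3 : |(e.repr c j : ℝ)| ≤ x := le_trans (by exact_mod_cast h2) hc.2.2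
    obtain ⟨h4, h5⟩ := abs_le.1 h3
    constructor
    · rw [Int.le_floor]
      push_cast
      have : -(x / h') ≤ (e.repr c j : ℝ) / h' := by rw [← neg_div]; gcongr
      linarith [Int.lt_floor_add_one (x / h')]
    · exact Int.floor_le_floor (by gcongr)
  have hle := Set.ncard_le_ncard_of_injOn f hmaps hinj (Finset.finite_toSet _)
  rw [Set.ncard_coe_finset, Fintype.card_piFinset_const, Int.card_Icc] at hle
  have hle2 : (A.ncard : ℝ) ≤ (6 * (x / h')) ^ d := by
    refine le_trans (by exact_mod_cast hle : (A.ncard : ℝ) ≤ ((R + 1 - (-R - 1)).toNat : ℝ) ^ d) ?_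
    gcongr
    have h1 : ((R + 1 - (-R - 1)).toNat : ℤ) = R + 1 - (-R - 1) := Int.toNat_of_nonneg (by omega)
    have h2 : ((R + 1 - (-R - 1)).toNat : ℝ) = R + 1 - (-R - 1) := by exact_mod_cast h1
    have h3 := Int.floor_le (x / h')
    have h4 : 1 ≤ x / h' := (one_le_div hh'pos).2 hhx
    rw [h2]
    linarith
  refine hle2.trans (le_of_eq ?_)
  rw [← hpow, mul_pow, div_pow, mul_pow]
  field_simp

end GeomNorm

/-! ### Squarefree ideals as finite sets of primes -/

section Rad

variable {K : Type*} [Field K] [NumberField K]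

/-- The product of the primes in a finite set. -/
noncomputable def rad (A : Finset (HeightOneSpectrum (𝓞 K))) : Ideal (𝓞 K) := ∏ p ∈ A, p.asIdeal

/-- The norm of the product of the primes in a finite set. -/
noncomputable def radNorm (A : Finset (HeightOneSpectrum (𝓞 K))) : ℝ :=
  ∏ p ∈ A, (Ideal.absNorm p.asIdeal : ℝ)

lemma two_le_absNorm (p : HeightOneSpectrum (𝓞 K)) : 2 ≤ Ideal.absNorm p.asIdeal := by
  have h1 := absNorm_pos p.ne_bot
  have h2 : Ideal.absNorm p.asIdeal ≠ 1 := fun h =>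
    p.isPrime.ne_top (Ideal.absNorm_eq_one_iff.1 h)
  omega

lemma two_le_absNorm_real (p : HeightOneSpectrum (𝓞 K)) : (2 : ℝ) ≤ Ideal.absNorm p.asIdeal := by
  exact_mod_cast two_le_absNorm p

lemma absNorm_rad (A : Finset (HeightOneSpectrum (𝓞 K))) :
    (Ideal.absNorm (rad A) : ℝ) = radNorm A := by
  rw [rad, radNorm, map_prod, Nat.cast_prod]

lemma one_le_radNorm (A : Finset (HeightOneSpectrum (𝓞 K))) : 1 ≤ radNorm A :=
  Finset.prod_induction _ (1 ≤ ·) (fun _ _ => one_le_mul_of_one_le_of_one_le) le_rfl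
    fun p _ => le_trans (by norm_num) (two_le_absNorm_real p)

lemma radNorm_pos (A : Finset (HeightOneSpectrum (𝓞 K))) : 0 < radNorm A :=
  one_pos.trans_le (one_le_radNorm A)

lemma radNorm_mono {A B : Finset (HeightOneSpectrum (𝓞 K))} (h : A ⊆ B) :
    radNorm A ≤ radNorm B := by
  classical
  have : radNorm B = radNorm (B \ A) * radNorm A := (Finset.prod_sdiff h).symm
  rw [this]
  exact le_mul_of_one_le_left (radNorm_pos A).le (one_le_radNorm _)

lemma rad_ne_bot {K : Type*} [Field K] (A : Finset (HeightOneSpectrum (𝓞 K))) : rad A ≠ ⊥ :=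
  Finset.prod_ne_zero_iff.2 fun p _ => p.ne_bot

lemma rad_pow_eq_inf (A : Finset (HeightOneSpectrum (𝓞 K))) (k : ℕ) :
    rad A ^ k = A.inf fun p => p.asIdeal ^ k := by
  rw [rad, ← Finset.prod_pow]
  exact (IsDedekindDomain.inf_pow_eq_prod_of_prime A _ (fun _ => k) (fun p _ => p.prime)
    fun p _ q _ h1 h2 => h1 (HeightOneSpectrum.ext h2)).symm

lemma mem_rad_pow {A : Finset (HeightOneSpectrum (𝓞 K))} {k : ℕ} {c : 𝓞 K} :
    c ∈ rad A ^ k ↔ ∀ p ∈ A, c ∈ p.asIdeal ^ k := by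
  rw [rad_pow_eq_inf, Submodule.mem_finsetInf]

lemma rad_le_iff {A : Finset (HeightOneSpectrum (𝓞 K))} {p : HeightOneSpectrum (𝓞 K)} :
    rad A ≤ p.asIdeal ↔ p ∈ A := by
  constructor
  · intro h
    obtain ⟨q, hq, hqp⟩ := (p.isPrime.prod_le).1 h
    rwa [← HeightOneSpectrum.ext (q.isMaximal.eq_of_le p.isPrime.ne_top hqp)]
  · intro h
    exact (p.isPrime.prod_le).2 ⟨p, h, le_rfl⟩

lemma rad_injective : Function.Injective (rad (K := K)) := by
  intro A B h
  ext p
  rw [← rad_le_iff, h, rad_le_iff]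

lemma isRelPrime_rad {A : Finset (HeightOneSpectrum (𝓞 K))} {p : HeightOneSpectrum (𝓞 K)}
    (hp : p ∉ A) : IsRelPrime p.asIdeal (rad A) := by
  refine (p.irreducible.isRelPrime_iff_not_dvd).2 fun h => hp ?_
  exact rad_le_iff.1 (Ideal.le_of_dvd h)

lemma moebius_rad (A : Finset (HeightOneSpectrum (𝓞 K))) :
    UniqueFactorizationMonoid.moebius (rad A) = (-1) ^ A.card := by
  classical
  induction A using Finset.induction_on with
  | empty =>
    rw [rad, Finset.prod_empty, UniqueFactorizationMonoid.moebius_one, Finset.card_empty, pow_zero]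
  | insert p A hp ih =>
    have h : rad (insert p A) = p.asIdeal * rad A := Finset.prod_insert hp
    rw [h, (isRelPrime_rad hp).moebius_mul, ih, p.irreducible.moebius_eq,
      Finset.card_insert_of_notMem hp, pow_succ']

lemma exists_rad_eq_of_squarefree {I : Ideal (𝓞 K)} (hI : I ≠ ⊥) (h : Squarefree I) :
    ∃ A, rad A = I := by
  classical
  revert hI h
  refine UniqueFactorizationMonoid.induction_on_prime I (fun h => absurd rfl h) ?_ ?_
  · intro J hJ _ _
    exact ⟨∅, by rw [Ideal.isUnit_iff.1 hJ]; simp [rad]⟩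
  · intro J q hJ hq ih _ h
    obtain ⟨A, rfl⟩ := ih hJ (h.of_mul_right)
    let p : HeightOneSpectrum (𝓞 K) := ⟨q, Ideal.isPrime_of_prime hq, hq.ne_zero⟩
    have hp : p ∉ A := by
      intro hp
      obtain ⟨J', hJ'⟩ := Ideal.dvd_iff_le.2 (rad_le_iff.2 hp)
      refine hq.not_isUnit (h q ⟨J', ?_⟩)
      rw [hJ', mul_assoc]
    exact ⟨insert p A, Finset.prod_insert hp⟩

/-! ### Sums over primes and over squarefree ideals -/

lemma exists_sum_card_absNorm_le : (fun n : ℕ => ∑ k ∈ Finset.Icc 1 n,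
      (Nat.card {I : Ideal (𝓞 K) // Ideal.absNorm I = k} : ℝ)) =O[Filter.atTop]
        fun n => (n : ℝ) ^ (1 : ℝ) := by
  have h := ((Ideal.tendsto_norm_le_div_atTop₀ K).comp tendsto_natCast_atTop_atTop).isBigO_one ℝ
  have h2 := h.mul (Asymptotics.isBigO_refl (fun n : ℕ => (n : ℝ)) Filter.atTop)
  refine (h2.congr' ?_ ?_)
  · filter_upwards [Filter.eventually_gt_atTop 0] with n hn
    have hn' : (n : ℝ) ≠ 0 := by exact_mod_cast hn.ne'
    simp only [Function.comp_apply, Nat.cast_le, ← Nat.cast_sum]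
    rw [div_mul_cancel₀ _ hn']
    congr 1
    -- The added 1 is the zero ideal, the only one of norm 0.
    rw [← add_left_inj 1, ← Ideal.card_norm_le_eq_card_norm_le_add_one,
      show Finset.Icc 1 n = Finset.Ioc 0 n from Finset.Icc_succ_left_eq_Ioc _ _,
      show 1 = Nat.card {I : Ideal (𝓞 K) // Ideal.absNorm I = 0} by
        simp [Ideal.absNorm_eq_zero_iff],
      Finset.sum_Ioc_add_eq_sum_Icc (n.zero_le),
      ← Finset.card_preimage_eq_sum_card_image_eq (fun k _ => Ideal.finite_setOfPred_absNorm_eq k)]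
    simp [Set.coe_eq_subtype]
  · exact Filter.Eventually.of_forall fun n => by simp

lemma card_filter_absNorm_eq_le [DecidableEq ℕ] (T : Finset (HeightOneSpectrum (𝓞 K))) (n : ℕ) :
    (T.filter fun p => Ideal.absNorm p.asIdeal = n).card ≤
      Nat.card {I : Ideal (𝓞 K) // Ideal.absNorm I = n} := by
  rw [← Set.ncard_coe_finset]
  exact Set.ncard_le_ncard_of_injOn (t := {I : Ideal (𝓞 K) | Ideal.absNorm I = n})
    (fun p : HeightOneSpectrum (𝓞 K) => p.asIdeal)
    (fun p hp => (Finset.mem_filter.1 (Finset.mem_coe.1 hp)).2)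
    (fun p _ q _ h => HeightOneSpectrum.ext h) (Ideal.finite_setOfPred_absNorm_eq n)

/-- The number of ideals of norm at most `n` is `O(n)`, so the Dirichlet series counting ideals
converges for `σ > 1`; it dominates the sum over primes. -/
lemma summable_absNorm_rpow {σ : ℝ} (hσ : 1 < σ) :
    Summable fun p : HeightOneSpectrum (𝓞 K) => (Ideal.absNorm p.asIdeal : ℝ) ^ (-σ) := by
  classical
  have h := LSeriesSummable_of_sum_norm_bigO_and_nonneg (s := (σ : ℂ))
    (exists_sum_card_absNorm_le (K := K)) (fun _ => Nat.cast_nonneg _) zero_le_one (by simpa using hσ)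
  have h2 := h.norm
  set f : ℕ → ℝ := fun n => (Nat.card {I : Ideal (𝓞 K) // Ideal.absNorm I = n} : ℝ) with hf
  have h3 : Summable fun n : ℕ => f n * (n : ℝ) ^ (-σ) := by
    refine Summable.of_nonneg_of_le (fun n => by positivity) (fun n => ?_) h2
    rw [LSeries.norm_term_eq]
    split_ifs with hn
    · rw [hn, Nat.cast_zero, Real.zero_rpow (by linarith), mul_zero]
    · rw [Complex.norm_real, Real.norm_of_nonneg (Nat.cast_nonneg _), Complex.ofReal_re,
        Real.rpow_neg (Nat.cast_nonneg _), div_eq_mul_inv]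
  refine summable_of_sum_le (fun p => by positivity) (c := ∑' n, f n * (n : ℝ) ^ (-σ)) fun T => ?_
  refine (Finset.sum_comp (s := T) (fun n : ℕ => (n : ℝ) ^ (-σ))
    (fun p => Ideal.absNorm p.asIdeal)).trans_le ?_
  refine le_trans (Finset.sum_le_sum fun n _ => ?_)
    (h3.sum_le_tsum _ fun n _ => by positivity)
  rw [nsmul_eq_mul]
  exact mul_le_mul_of_nonneg_right (Nat.cast_le.2 (card_filter_absNorm_eq_le T n)) (by positivity)

lemma radNorm_rpow (A : Finset (HeightOneSpectrum (𝓞 K))) (σ : ℝ) :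
    radNorm A ^ σ = ∏ p ∈ A, (Ideal.absNorm p.asIdeal : ℝ) ^ σ :=
  (Real.finsetProd_rpow _ _ (fun _ _ => Nat.cast_nonneg _) _).symm

lemma summable_pow_card_mul_radNorm_rpow {σ : ℝ} (hσ : 1 < σ) {c : ℝ} (hc : 0 ≤ c) :
    Summable fun A : Finset (HeightOneSpectrum (𝓞 K)) => c ^ A.card * radNorm A ^ (-σ) := by
  refine (summable_finsetProd_of_summable_nonneg
    (f := fun p : HeightOneSpectrum (𝓞 K) => c * (Ideal.absNorm p.asIdeal : ℝ) ^ (-σ))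
    (fun p => by positivity) ((summable_absNorm_rpow hσ).mul_left c)).congr fun A => ?_
  rw [Finset.prod_mul_distrib, Finset.prod_const, radNorm_rpow]

lemma finite_absNorm_le (n : ℕ) :
    {p : HeightOneSpectrum (𝓞 K) | Ideal.absNorm p.asIdeal ≤ n}.Finite :=
  (Ideal.finite_setOfPred_absNorm_le n).preimage fun _ _ _ _ h => HeightOneSpectrum.ext h

/-- The divisor bound: all but finitely many primes satisfy `N(p)^ε ≥ 2`, and the exceptional ones
cost a constant. -/
lemma exists_two_pow_card_le {ε : ℝ} (hε : 0 < ε) : ∃ C : ℝ, 1 ≤ C ∧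
    ∀ A : Finset (HeightOneSpectrum (𝓞 K)), (2 : ℝ) ^ A.card ≤ C * radNorm A ^ ε := by
  classical
  set F := (finite_absNorm_le (K := K) ⌈(2 : ℝ) ^ ε⁻¹⌉₊).toFinset with hF
  refine ⟨2 ^ F.card, one_le_pow₀ (by norm_num), fun A => ?_⟩
  rw [radNorm_rpow, ← Finset.prod_const]
  have h1 : ∀ p ∈ A, (2 : ℝ) ≤ (if p ∈ F then 2 else 1) * (Ideal.absNorm p.asIdeal : ℝ) ^ ε := by
    intro p _
    have h2 : (1 : ℝ) ≤ (Ideal.absNorm p.asIdeal : ℝ) ^ ε :=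
      Real.one_le_rpow (le_trans (by norm_num) (two_le_absNorm_real p)) hε.le
    split_ifs with hp
    · linarith
    · rw [one_mul]
      have h3 : ⌈(2 : ℝ) ^ ε⁻¹⌉₊ < Ideal.absNorm p.asIdeal := by
        by_contra hle
        exact hp (by rw [hF, Set.Finite.mem_toFinset]; exact not_lt.1 hle)
      have h4 : (2 : ℝ) ^ ε⁻¹ ≤ Ideal.absNorm p.asIdeal :=
        (Nat.le_ceil _).trans (by exact_mod_cast h3.le)
      calc (2 : ℝ) = ((2 : ℝ) ^ ε⁻¹) ^ ε := by
            rw [← Real.rpow_mul (by norm_num), inv_mul_cancel₀ hε.ne', Real.rpow_one]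
        _ ≤ _ := Real.rpow_le_rpow (by positivity) h4 hε.le
  refine (Finset.prod_le_prod (fun _ _ => by norm_num) h1).trans ?_
  rw [Finset.prod_mul_distrib]
  refine mul_le_mul_of_nonneg_right ?_ (Finset.prod_nonneg fun _ _ => by positivity)
  rw [Finset.prod_ite, Finset.prod_const_one, mul_one, Finset.prod_const]
  exact pow_le_pow_right₀ (by norm_num)
    (Finset.card_le_card fun p hp => (Finset.mem_filter.1 hp).2)

lemma finite_radNorm_le (y : ℝ) :
    {A : Finset (HeightOneSpectrum (𝓞 K)) | radNorm A ≤ y}.Finite := by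
  refine ((Ideal.finite_setOfPred_absNorm_le (S := 𝓞 K) ⌊y⌋₊).preimage
    rad_injective.injOn).subset fun A hA => ?_
  refine Nat.le_floor ?_
  rw [absNorm_rad]
  exact hA

/-- Rankin's trick with exponent 2. The crude `y ^ 2` is enough for the exponent sought, and it
avoids an `ε` here. -/
lemma exists_card_radNorm_le : ∃ C : ℝ, 0 ≤ C ∧ ∀ y : ℝ,
    ((finite_radNorm_le (K := K) y).toFinset.card : ℝ) ≤ C * y ^ 2 := by
  have hs := summable_pow_card_mul_radNorm_rpow (K := K) (σ := 2) (by norm_num) (c := 1) (by norm_num)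
  refine ⟨∑' A : Finset (HeightOneSpectrum (𝓞 K)), 1 ^ A.card * radNorm A ^ (-2 : ℝ),
    tsum_nonneg fun A => by have := radNorm_pos A; positivity, fun y => ?_⟩
  set F := (finite_radNorm_le (K := K) y).toFinset with hF
  calc (F.card : ℝ) = ∑ A ∈ F, 1 := by simp
    _ ≤ ∑ A ∈ F, (1 ^ A.card * radNorm A ^ (-2 : ℝ)) * y ^ 2 := by
        refine Finset.sum_le_sum fun A hA => ?_
        have h1 : radNorm A ≤ y := (finite_radNorm_le y).mem_toFinset.1 hA
        have h0 := radNorm_pos A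
        rw [one_pow, one_mul, Real.rpow_neg h0.le, Real.rpow_two, inv_mul_eq_div,
          one_le_div (by positivity)]
        gcongr
    _ ≤ _ := by
        rw [← Finset.sum_mul]
        gcongr
        exact hs.sum_le_tsum _ fun A _ => by have := radNorm_pos A; positivity

end Rad

/-! ### The singular series and its Euler product -/

section Euler

variable {K : Type*} [Field K] [NumberField K]

lemma sum_powerset_indicator_rad_pow (P : Finset (HeightOneSpectrum (𝓞 K))) (k : ℕ) (c : 𝓞 K)
    [DecidablePred fun A : Finset (HeightOneSpectrum (𝓞 K)) => c ∈ rad A ^ k]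
    [Decidable (∀ p ∈ P, c ∉ p.asIdeal ^ k)] :
    ∑ A ∈ P.powerset, (-1 : ℝ) ^ A.card * (if c ∈ rad A ^ k then 1 else 0) =
      if ∀ p ∈ P, c ∉ p.asIdeal ^ k then 1 else 0 := by
  classical
  simp only [mul_ite, mul_one, mul_zero]
  rw [← Finset.sum_filter]
  have h1 : {A ∈ P.powerset | c ∈ rad A ^ k} = {p ∈ P | c ∈ p.asIdeal ^ k}.powerset := by
    ext A
    simp only [Finset.mem_filter, Finset.mem_powerset, mem_rad_pow, Finset.subset_iff]
    exact ⟨fun h p hp => ⟨h.1 hp, h.2 p hp⟩, fun h => ⟨fun p hp => (h hp).1, fun p hp => (h hp).2⟩⟩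
  rw [h1]
  have h2 := Finset.sum_powerset_neg_one_pow_card (x := {p ∈ P | c ∈ p.asIdeal ^ k})
  have h3 : (∑ A ∈ {p ∈ P | c ∈ p.asIdeal ^ k}.powerset, (-1 : ℝ) ^ A.card) =
      if {p ∈ P | c ∈ p.asIdeal ^ k} = ∅ then 1 else 0 := by exact_mod_cast congrArg (Int.cast (R := ℝ)) h2
  rw [h3]
  simp only [Finset.filter_eq_empty_iff]

lemma finite_quotient {Q : Ideal (𝓞 K)} (hQ : Q ≠ ⊥) : Finite (𝓞 K ⧸ Q) :=
  Ideal.finiteQuotientOfFreeOfNeBot Q hQ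

lemma ncard_coset_mul_absNorm {Q L : Ideal (𝓞 K)} (hQL : Q ≤ L) (t : 𝓞 K) :
    {ρ : 𝓞 K ⧸ Q | ∃ c, Ideal.Quotient.mk Q c = ρ ∧ c - t ∈ L}.ncard * Ideal.absNorm L =
      Ideal.absNorm Q := by
  let f : 𝓞 K →+ 𝓞 K ⧸ Q := (Ideal.Quotient.mk Q : 𝓞 K →+ 𝓞 K ⧸ Q)
  have hf : Function.Surjective f := Ideal.Quotient.mk_surjective
  let H : AddSubgroup (𝓞 K ⧸ Q) := L.toAddSubgroup.map f
  have hker : f.ker ≤ L.toAddSubgroup := by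
    intro c hc
    exact hQL (Ideal.Quotient.eq_zero_iff_mem.1 hc)
  have hidx : H.index = Ideal.absNorm L := AddSubgroup.index_map_eq _ hf hker
  have hset : {ρ : 𝓞 K ⧸ Q | ∃ c, Ideal.Quotient.mk Q c = ρ ∧ c - t ∈ L} =
      (fun ρ => ρ + Ideal.Quotient.mk Q t) '' (H : Set (𝓞 K ⧸ Q)) := by
    ext ρ
    constructor
    · rintro ⟨c, rfl, hc⟩
      exact ⟨f (c - t), ⟨c - t, hc, rfl⟩, by simp [f]⟩
    · rintro ⟨_, ⟨c, hc, rfl⟩, rfl⟩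
      exact ⟨c + t, by simp [f], by simpa using hc⟩
  rw [hset, Set.ncard_image_of_injective _ (add_left_injective _), ← hidx]
  exact H.card_mul_index

variable (k : ℕ) (b : Ideal (𝓞 K)) {s : ℕ} (a : Fin s → 𝓞 K)

/-- The classes modulo `Q` of the elements `c` of `b` such that no `c + a_i` is divisible by the
`k`-th power of a prime in `P`. -/
def goodClasses (Q : Ideal (𝓞 K)) (P : Finset (HeightOneSpectrum (𝓞 K))) : Set (𝓞 K ⧸ Q) :=
  {ρ | ∃ c ∈ b, Ideal.Quotient.mk Q c = ρ ∧ ∀ p ∈ P, ∀ i, c + a i ∉ p.asIdeal ^ k}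

lemma mem_goodClasses {Q : Ideal (𝓞 K)} {P : Finset (HeightOneSpectrum (𝓞 K))}
    (hQ : Q ≤ b ⊓ rad P ^ k) (c : 𝓞 K) :
    Ideal.Quotient.mk Q c ∈ goodClasses k b a Q P ↔
      c ∈ b ∧ ∀ p ∈ P, ∀ i, c + a i ∉ p.asIdeal ^ k := by
  constructor
  · rintro ⟨c', hc', h1, h2⟩
    have h3 := hQ (Ideal.Quotient.eq.1 h1)
    refine ⟨?_, fun p hp i h => h2 p hp i ?_⟩
    · have := b.sub_mem hc' h3.1
      simpa using this
    · have := (p.asIdeal ^ k).add_mem h (mem_rad_pow.1 h3.2 p hp)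
      convert this using 1; ring
  · rintro ⟨h1, h2⟩
    exact ⟨c, h1, rfl, h2⟩

/-- Chinese remainder theorem inside `b`: two elements of `b` agree modulo `b ⊓ rad P ^ k` as soon
as they agree modulo each `p ^ k`, so `b` need not be coprime to `P`. -/
lemma ncard_goodClasses_eq_prod (P : Finset (HeightOneSpectrum (𝓞 K))) :
    (goodClasses k b a (b ⊓ rad P ^ k) P).ncard =
      ∏ p ∈ P, (goodClasses k b a (p.asIdeal ^ k) {p}).ncard := by
  classical
  set Q := b ⊓ rad P ^ k
  let f : 𝓞 K ⧸ Q → ∀ p : P, 𝓞 K ⧸ p.1.asIdeal ^ k :=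
    fun ρ p => Ideal.Quotient.mk _ (Quotient.out ρ)
  have hout : ∀ ρ : 𝓞 K ⧸ Q, Ideal.Quotient.mk Q (Quotient.out ρ) = ρ := fun ρ =>
    Quotient.out_eq ρ
  have hbij : Set.BijOn f (goodClasses k b a Q P)
      (Set.univ.pi fun p : P => goodClasses k b a (p.1.asIdeal ^ k) {p.1}) := by
    refine ⟨fun ρ hρ p _ => ?_, fun ρ hρ ρ' hρ' h => ?_, fun η hη => ?_⟩
    · rw [← hout ρ, mem_goodClasses k b a le_rfl] at hρ
      exact ⟨_, hρ.1, rfl, fun q hq i => by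
        rw [Finset.mem_singleton.1 hq]; exact hρ.2 p.1 p.2 i⟩
    · rw [← hout ρ, mem_goodClasses k b a le_rfl] at hρ
      rw [← hout ρ', mem_goodClasses k b a le_rfl] at hρ'
      rw [← hout ρ, ← hout ρ']
      refine Ideal.Quotient.eq.2 ⟨b.sub_mem hρ.1 hρ'.1, mem_rad_pow.2 fun p hp => ?_⟩
      exact Ideal.Quotient.eq.1 (congrFun h ⟨p, hp⟩)
    · choose g hgb hgη hg using fun p : P => hη p (Set.mem_univ p)
      have hcrt := fun p : P => IsDedekindDomain.exists_forall_sub_mem_ideal (s := P)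
        (fun q => q.asIdeal) (fun _ => k) (fun q _ => q.prime)
        (fun q _ q' _ h1 h2 => h1 (HeightOneSpectrum.ext h2))
        (fun q : P => if q = p then (1 : 𝓞 K) else 0)
      choose u hu using hcrt
      have hc : ∀ q : P, ∑ p : P, u p * g p - g q ∈ q.1.asIdeal ^ k := by
        intro q
        have : ∑ p : P, u p * g p - g q = ∑ p : P, (u p - if q = p then 1 else 0) * g p := by
          simp only [sub_mul, Finset.sum_sub_distrib, ite_mul, one_mul, zero_mul,
            Finset.sum_ite_eq, Finset.mem_univ, if_true]
        rw [this]
        exact Ideal.sum_mem _ fun p _ => Ideal.mul_mem_right _ _ (hu p q.1 q.2)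
      -- Gluing representatives that already lie in `b` keeps the combination in `b`, whatever the
      -- coefficients `u p`.
      have hcb : ∑ p : P, u p * g p ∈ b := Ideal.sum_mem _ fun p _ => b.mul_mem_left _ (hgb p)
      have hgood : Ideal.Quotient.mk Q (∑ p : P, u p * g p) ∈ goodClasses k b a Q P := by
        rw [mem_goodClasses k b a le_rfl]
        refine ⟨hcb, fun p hp i h => hg ⟨p, hp⟩ p (Finset.mem_singleton_self p) i ?_⟩
        have := (p.asIdeal ^ k).sub_mem h (hc ⟨p, hp⟩)
        convert this using 1; ring
      refine ⟨_, hgood, ?_⟩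
      funext q
      rw [← hgη q]
      have h1 : Quotient.out (Ideal.Quotient.mk Q (∑ p : P, u p * g p)) - ∑ p : P, u p * g p ∈ Q :=
        Ideal.Quotient.eq.1 (hout _)
      refine Ideal.Quotient.eq.2 ?_
      have := (q.1.asIdeal ^ k).add_mem (mem_rad_pow.1 h1.2 q.1 q.2) (hc q)
      convert this using 1; ring
  rw [← Finset.prod_coe_sort, ← hbij.injOn.ncard_image, hbij.image_eq, Set.ncard,
    Set.encard_pi_eq_prod_encard]
  exact map_prod ENat.toNatHom _ _

/-- With no shifts every class of `b` is good, so this is the order of the image of `b` in the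
quotient by `Q`: the denominator of all later proportions. -/
lemma ncard_goodClasses_elim0 {Q : Ideal (𝓞 K)} (P : Finset (HeightOneSpectrum (𝓞 K))) :
    (goodClasses k b (Fin.elim0 : Fin 0 → 𝓞 K) Q P).ncard * Ideal.absNorm (Q ⊔ b) =
      Ideal.absNorm Q := by
  rw [← ncard_coset_mul_absNorm (Q := Q) (L := Q ⊔ b) le_sup_left 0]
  congr 2
  ext ρ
  constructor
  · rintro ⟨c, hc, h, -⟩
    exact ⟨c, h, by rw [sub_zero]; exact Ideal.mem_sup_right hc⟩
  · rintro ⟨c, rfl, h⟩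
    rw [sub_zero] at h
    obtain ⟨q, hq, c', hc', rfl⟩ := Submodule.mem_sup.1 h
    exact ⟨c', hc', by
      rw [map_add, Ideal.Quotient.eq_zero_iff_mem.2 hq, zero_add], fun _ _ i => i.elim0⟩

lemma pow_ne_bot (p : HeightOneSpectrum (𝓞 K)) : p.asIdeal ^ k ≠ ⊥ := pow_ne_zero k p.ne_bot

/-- `D` counts the complementary bad classes, up to sign: it tests `c - a i`, whereas goodness tests
`c + a i`, hence the negation. -/
lemma ncard_goodClasses_add_D (p : HeightOneSpectrum (𝓞 K)) :
    (goodClasses k b a (p.asIdeal ^ k) {p}).ncard + D (p.asIdeal ^ k) b a =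
      (goodClasses k b (Fin.elim0 : Fin 0 → 𝓞 K) (p.asIdeal ^ k) {p}).ncard := by
  have := finite_quotient (pow_ne_bot k p)
  set Q := p.asIdeal ^ k with hQ
  set H := goodClasses k b (Fin.elim0 : Fin 0 → 𝓞 K) Q {p} with hH
  have hneg : (goodClasses k b a Q {p}).ncard = ((fun ρ => -ρ) '' goodClasses k b a Q {p}).ncard :=
    (Set.ncard_image_of_injective _ neg_injective).symm
  rw [hneg, D, ← Set.ncard_union_eq]
  · congr 1
    ext ρ
    constructor
    · rintro (⟨_, ⟨c, hc, rfl, -⟩, rfl⟩ | ⟨c, rfl, -, h⟩)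
      · exact ⟨-c, b.neg_mem hc, by simp, fun _ _ i => i.elim0⟩
      · obtain ⟨q, hq, c', hc', rfl⟩ := Submodule.mem_sup.1 h
        exact ⟨c', hc', by
          rw [map_add, Ideal.Quotient.eq_zero_iff_mem.2 hq, zero_add], fun _ _ i => i.elim0⟩
    · rintro ⟨c, hc, rfl, -⟩
      by_cases h : ∃ i, c - a i ∈ Q
      · exact Or.inr ⟨c, rfl, h, Ideal.mem_sup_right hc⟩
      · refine Or.inl ⟨Ideal.Quotient.mk Q (-c), ⟨-c, b.neg_mem hc, rfl, fun q hq i hi => h ⟨i, ?_⟩⟩,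
          by simp⟩
        rw [Finset.mem_singleton.1 hq] at hi
        have := Q.neg_mem hi
        convert this using 1; ring
  · rw [Set.disjoint_left]
    rintro _ ⟨_, ⟨c, hc, rfl, h⟩, rfl⟩ ⟨c', h', ⟨i, hi⟩, -⟩
    refine h p (Finset.mem_singleton_self p) i ?_
    replace h' : Ideal.Quotient.mk Q c' = Ideal.Quotient.mk Q (-c) := h'.trans (map_neg _ _).symm
    have h1 := Ideal.Quotient.eq.1 h'
    have := Q.sub_mem h1 hi
    convert this using 1; ring

lemma ncard_goodClasses_elim0_pos {Q : Ideal (𝓞 K)} (hQ : Q ≠ ⊥)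
    (P : Finset (HeightOneSpectrum (𝓞 K))) :
    0 < (goodClasses k b (Fin.elim0 : Fin 0 → 𝓞 K) Q P).ncard := by
  refine Nat.pos_of_ne_zero fun h => ?_
  have h1 := ncard_goodClasses_elim0 k b (Q := Q) P
  rw [h, zero_mul] at h1
  exact (absNorm_pos hQ).ne h1

lemma eulerFactor_eq_div (p : HeightOneSpectrum (𝓞 K)) :
    eulerFactor k b a p = ((goodClasses k b a (p.asIdeal ^ k) {p}).ncard : ℝ) /
      (goodClasses k b (Fin.elim0 : Fin 0 → 𝓞 K) (p.asIdeal ^ k) {p}).ncard := by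
  have h1 := ncard_goodClasses_elim0 k b (Q := p.asIdeal ^ k) {p}
  have h2 := ncard_goodClasses_add_D k b a p
  have h3 := ncard_goodClasses_elim0_pos k b (pow_ne_bot k p) {p}
  have h4 := absNorm_pos (pow_ne_bot k p)
  set H := (goodClasses k b (Fin.elim0 : Fin 0 → 𝓞 K) (p.asIdeal ^ k) {p}).ncard
  set X := (goodClasses k b a (p.asIdeal ^ k) {p}).ncard
  have h1' : (H : ℝ) * Ideal.absNorm (p.asIdeal ^ k ⊔ b) = Ideal.absNorm (p.asIdeal ^ k) := by
    exact_mod_cast h1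
  have h2' : (X : ℝ) + D (p.asIdeal ^ k) b a = H := by exact_mod_cast h2
  have h3' : (H : ℝ) ≠ 0 := by exact_mod_cast h3.ne'
  have h4' : (Ideal.absNorm (p.asIdeal ^ k) : ℝ) ≠ 0 := by exact_mod_cast h4.ne'
  have h5 : (Ideal.absNorm (p.asIdeal ^ k ⊔ b) : ℝ) ≠ 0 := by
    intro h; rw [h, mul_zero] at h1'; exact h4' h1'.symm
  rw [eulerFactor, ← h1', mul_comm (H : ℝ), mul_div_mul_left _ _ h5, eq_div_iff h3', sub_mul,
    div_mul_cancel₀ _ h3']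
  linarith

lemma obstructed_iff_eulerFactor_eq_zero (p : HeightOneSpectrum (𝓞 K)) :
    Obstructed k b a p ↔ eulerFactor k b a p = 0 := by
  have h4 : (Ideal.absNorm (p.asIdeal ^ k) : ℝ) ≠ 0 := by
    exact_mod_cast (absNorm_pos (pow_ne_bot k p)).ne'
  have h5 : (Ideal.absNorm (p.asIdeal ^ k ⊔ b) : ℝ) ≠ 0 := by
    have : p.asIdeal ^ k ⊔ b ≠ ⊥ := ne_bot_of_le_ne_bot (pow_ne_bot k p) le_sup_left
    exact_mod_cast (absNorm_pos this).ne'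
  rw [Obstructed, eulerFactor, eq_div_iff h5, sub_eq_zero, eq_div_iff h4, one_mul, mul_comm]
  exact eq_comm

lemma eulerFactor_nonneg (p : HeightOneSpectrum (𝓞 K)) : 0 ≤ eulerFactor k b a p := by
  rw [eulerFactor_eq_div]; positivity

lemma eulerFactor_le_one (p : HeightOneSpectrum (𝓞 K)) : eulerFactor k b a p ≤ 1 := by
  rw [eulerFactor]
  have : 0 ≤ (Ideal.absNorm (p.asIdeal ^ k ⊔ b) : ℝ) * (D (p.asIdeal ^ k) b a : ℝ) /
    (Ideal.absNorm (p.asIdeal ^ k) : ℝ) := by positivity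
  linarith

/-- Here `b` has a single class modulo `p ^ k`, so the proportion of good classes is 0 or 1. This is
why such primes may be dropped from the product. -/
lemma eulerFactor_eq_one_of_le {p : HeightOneSpectrum (𝓞 K)} (h : b ≤ p.asIdeal ^ k)
    (hp : ¬ Obstructed k b a p) : eulerFactor k b a p = 1 := by
  have h0 := mt (obstructed_iff_eulerFactor_eq_zero k b a p).2 hp
  have h1 := ncard_goodClasses_elim0 k b (Q := p.asIdeal ^ k) {p}
  rw [sup_eq_left.2 h] at h1
  have h2 := Nat.eq_of_mul_eq_mul_right (absNorm_pos (pow_ne_bot k p)) (h1.trans (one_mul _).symm)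
  have h3 := ncard_goodClasses_add_D k b a p
  rw [eulerFactor_eq_div, h2] at h0 ⊢
  rw [h2] at h3
  have h4 : (goodClasses k b a (p.asIdeal ^ k) {p}).ncard ≠ 0 := fun h => h0 (by simp [h])
  have h5 : (goodClasses k b a (p.asIdeal ^ k) {p}).ncard = 1 := by omega
  rw [h5]; simp

lemma D_le (Q : Ideal (𝓞 K)) : D Q b a ≤ s := by
  have h : {ρ : 𝓞 K ⧸ Q | ∃ c : 𝓞 K, Ideal.Quotient.mk Q c = ρ ∧ (∃ i, c - a i ∈ Q) ∧ c ∈ Q ⊔ b} ⊆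
      (fun i => Ideal.Quotient.mk Q (a i)) '' Set.univ := by
    rintro _ ⟨c, rfl, ⟨i, hi⟩, -⟩
    exact ⟨i, Set.mem_univ i, (Ideal.Quotient.eq.2 hi).symm⟩
  calc D Q b a ≤ _ := Set.ncard_le_ncard h (Set.finite_univ.image _)
    _ ≤ _ := Set.ncard_image_le Set.finite_univ
    _ = s := by rw [Set.ncard_univ, Nat.card_eq_fintype_card, Fintype.card_fin]

/-- The term of the singular series indexed by a tuple of squarefree ideals. -/
noncomputable def radTerm (A : Fin s → Finset (HeightOneSpectrum (𝓞 K))) : ℝ :=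
  STerm k b a fun i => ⟨rad (A i), rad_ne_bot (A i)⟩

lemma radTerm_eq (A : Fin s → Finset (HeightOneSpectrum (𝓞 K))) :
    radTerm k b a A = (∏ i, (-1 : ℝ) ^ (A i).card) *
      ((E b (fun i => rad (A i) ^ k) a : ℝ) / Ideal.absNorm (b ⊓ ⨅ i, rad (A i) ^ k)) := by
  rw [radTerm, STerm]
  simp only [moebius_rad]
  push_cast
  ring

lemma inf_rad_pow_ne_bot (hb : b ≠ ⊥) (P : Finset (HeightOneSpectrum (𝓞 K))) :
    b ⊓ rad P ^ k ≠ ⊥ := by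
  intro h
  have h1 : b * rad P ^ k ≤ ⊥ := Ideal.mul_le_inf.trans h.le
  exact mul_ne_zero hb (pow_ne_zero k (rad_ne_bot P)) (le_bot_iff.1 h1)

/-- All conditions indexed by subsets of `P` depend only on the class modulo `Q`. Each term thus
counts, with sign, the classes in one coset; summing over tuples first, the sum factors over `i`
into indicators of avoiding `p ^ k` for all `p ∈ P`. -/
lemma sum_radTerm_mul_absNorm (hb : b ≠ ⊥) (P : Finset (HeightOneSpectrum (𝓞 K))) :
    (∑ A ∈ Fintype.piFinset fun _ : Fin s => P.powerset, radTerm k b a A) *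
      Ideal.absNorm (b ⊓ rad P ^ k) = (goodClasses k b a (b ⊓ rad P ^ k) P).ncard := by
  classical
  set Q := b ⊓ rad P ^ k with hQ
  have hQ0 : Q ≠ ⊥ := inf_rad_pow_ne_bot k b hb P
  have hfin := finite_quotient hQ0
  have := Fintype.ofFinite (𝓞 K ⧸ Q)
  have hout : ∀ ρ : 𝓞 K ⧸ Q, Ideal.Quotient.mk Q (Quotient.out ρ) = ρ := fun ρ =>
    Quotient.out_eq ρ
  have hterm : ∀ A ∈ Fintype.piFinset fun _ : Fin s => P.powerset,
      radTerm k b a A * Ideal.absNorm Q = ∑ ρ : 𝓞 K ⧸ Q, (if Quotient.out ρ ∈ b then 1 else 0) *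
        ∏ i, ((-1 : ℝ) ^ (A i).card * if Quotient.out ρ + a i ∈ rad (A i) ^ k then 1 else 0) := by
    intro A hA
    have hAP : ∀ i, A i ⊆ P := fun i => Finset.mem_powerset.1 (Fintype.mem_piFinset.1 hA i)
    set L := b ⊓ ⨅ i, rad (A i) ^ k with hL
    have hmemL : ∀ c, c ∈ L ↔ c ∈ b ∧ ∀ i, c ∈ rad (A i) ^ k := by
      intro c; rw [hL, Submodule.mem_inf, Submodule.mem_iInf]
    have hQL : Q ≤ L := by
      intro c hc
      exact (hmemL c).2 ⟨hc.1, fun i => mem_rad_pow.2 fun p hp =>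
        mem_rad_pow.1 hc.2 p (hAP i hp)⟩
    have hE : ((E b (fun i => rad (A i) ^ k) a : ℝ) / Ideal.absNorm L) * Ideal.absNorm Q =
        ({ρ : 𝓞 K ⧸ Q | Quotient.out ρ ∈ b ∧
          ∀ i, Quotient.out ρ + a i ∈ rad (A i) ^ k}.ncard : ℝ) := by
      rw [E]
      split_ifs with h
      · obtain ⟨t, htb, ht⟩ := h
        have hL0 : (Ideal.absNorm L : ℝ) ≠ 0 := by
          exact_mod_cast (absNorm_pos (ne_bot_of_le_ne_bot hQ0 hQL)).ne'
        rw [← ncard_coset_mul_absNorm hQL t]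
        push_cast
        rw [mul_comm (_ : ℝ) (Ideal.absNorm L : ℝ), ← mul_assoc, div_mul_cancel₀ _ hL0, one_mul]
        congr 2
        ext ρ
        have key : (Quotient.out ρ ∈ b ∧ ∀ i, Quotient.out ρ + a i ∈ rad (A i) ^ k) ↔
            Quotient.out ρ - t ∈ L := by
          rw [hmemL]
          refine and_congr (Submodule.sub_mem_iff_left _ htb).symm (forall_congr' fun i => ?_)
          rw [← Submodule.sub_mem_iff_left _ (ht i)]
          ring_nf
        rw [Set.mem_ofPred_eq, Set.mem_ofPred_eq, key]
        constructor
        · rintro ⟨c, hc, hct⟩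
          rw [← hout ρ] at hc
          have := L.sub_mem hct (hQL (Ideal.Quotient.eq.1 hc))
          convert this using 1; ring
        · exact fun h => ⟨_, hout ρ, h⟩
      · have : {ρ : 𝓞 K ⧸ Q | Quotient.out ρ ∈ b ∧
          ∀ i, Quotient.out ρ + a i ∈ rad (A i) ^ k} = ∅ := by
          rw [Set.eq_empty_iff_forall_notMem]
          intro ρ hρ
          exact h ⟨_, hρ.1, hρ.2⟩
        rw [this]; simp
    rw [radTerm_eq, mul_assoc, hE]
    simp only [Finset.prod_mul_distrib]
    rw [Set.ncard_eq_toFinset_card', Set.toFinset_ofPred, Finset.card_filter]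
    push_cast
    rw [Finset.mul_sum]
    refine Finset.sum_congr rfl fun ρ _ => ?_
    rw [Finset.prod_boole, ite_and]
    simp only [Finset.mem_univ, true_implies]
    split_ifs <;> simp
  rw [Finset.sum_mul, Finset.sum_congr rfl hterm, Finset.sum_comm]
  have hgood : goodClasses k b a Q P = (({ρ | Quotient.out ρ ∈ b ∧
      ∀ i, ∀ p ∈ P, Quotient.out ρ + a i ∉ p.asIdeal ^ k} : Finset (𝓞 K ⧸ Q)) : Set _) := by
    ext ρ
    rw [Finset.mem_coe, Finset.mem_filter_univ]
    conv_lhs => rw [← hout ρ, mem_goodClasses k b a le_rfl]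
    exact and_congr_right fun _ => ⟨fun h i p hp => h p hp i, fun h p hp i => h i p hp⟩
  rw [hgood, Set.ncard_coe_finset, Finset.card_filter]
  push_cast
  refine Finset.sum_congr rfl fun ρ _ => ?_
  rw [← Finset.mul_sum, ← Finset.prod_univ_sum (fun _ => P.powerset)
    (fun i A => (-1 : ℝ) ^ A.card * if Quotient.out ρ + a i ∈ rad A ^ k then 1 else 0)]
  simp only [sum_powerset_indicator_rad_pow]
  rw [Finset.prod_boole, ite_and]
  simp only [Finset.mem_univ, true_implies]
  split_ifs <;> simp

end Euler

/-! ### Convergence, Euler product and positivity of the singular series -/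

section Series

variable {K : Type*} [Field K] [NumberField K] (k : ℕ) (b : Ideal (𝓞 K)) {s : ℕ}
  (a : Fin s → 𝓞 K)

lemma absNorm_mul_sum_radTerm (hb : b ≠ ⊥) (P : Finset (HeightOneSpectrum (𝓞 K))) :
    (Ideal.absNorm b : ℝ) * ∑ A ∈ Fintype.piFinset fun _ : Fin s => P.powerset, radTerm k b a A =
      ∏ p ∈ P, eulerFactor k b a p := by
  have h1 := sum_radTerm_mul_absNorm k b a hb P
  set Q := b ⊓ rad P ^ k with hQ
  have hQ0 : Q ≠ ⊥ := inf_rad_pow_ne_bot k b hb P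
  have h2 := ncard_goodClasses_elim0 k b (Q := Q) P
  rw [sup_eq_right.2 inf_le_left] at h2
  have h3 := ncard_goodClasses_elim0_pos k b hQ0 P
  simp only [eulerFactor_eq_div]
  rw [Finset.prod_div_distrib, ← Nat.cast_prod, ← Nat.cast_prod, ← ncard_goodClasses_eq_prod,
    ← ncard_goodClasses_eq_prod, ← h1, ← hQ]
  rw [eq_div_iff (by exact_mod_cast h3.ne'), ← h2]
  push_cast
  ring

lemma inf_iInf_rad_pow_ne_bot (hb : b ≠ ⊥) (A : Fin s → Finset (HeightOneSpectrum (𝓞 K))) :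
    b ⊓ ⨅ i, rad (A i) ^ k ≠ ⊥ := by
  classical
  refine ne_bot_of_le_ne_bot (inf_rad_pow_ne_bot k b hb (Finset.univ.biUnion A)) ?_
  refine inf_le_inf_left _ (le_iInf fun i c hc => mem_rad_pow.2 fun p hp => ?_)
  exact mem_rad_pow.1 hc p (Finset.mem_biUnion.2 ⟨i, Finset.mem_univ i, hp⟩)

open scoped Classical in
-- The intersection of the ideals lies in `rad (⋃ A i) ^ k`, so its norm is at least that of this
-- power. Dropping `b` makes the bound uniform in `b` and `a`.
lemma abs_radTerm_le (hb : b ≠ ⊥) (A : Fin s → Finset (HeightOneSpectrum (𝓞 K))) :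
    |radTerm k b a A| ≤ (radNorm (Finset.univ.biUnion A) ^ k)⁻¹ := by
  have h1 : b ⊓ ⨅ i, rad (A i) ^ k ≤ rad (Finset.univ.biUnion A) ^ k := by
    intro c hc
    refine mem_rad_pow.2 fun p hp => ?_
    obtain ⟨i, -, hi⟩ := Finset.mem_biUnion.1 hp
    exact mem_rad_pow.1 ((Submodule.mem_iInf _).1 hc.2 i) p hi
  have h0 : 0 < Ideal.absNorm (b ⊓ ⨅ i, rad (A i) ^ k) := absNorm_pos (inf_iInf_rad_pow_ne_bot k b hb A)
  have h2 : radNorm (Finset.univ.biUnion A) ^ k ≤ Ideal.absNorm (b ⊓ ⨅ i, rad (A i) ^ k) := by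
    rw [← absNorm_rad, ← Nat.cast_pow, ← map_pow]
    exact_mod_cast Nat.le_of_dvd h0 (Ideal.absNorm_dvd_absNorm_of_le h1)
  have h3 : (E b (fun i => rad (A i) ^ k) a : ℝ) ≤ 1 := by
    rw [E]; split_ifs <;> simp
  rw [radTerm_eq, abs_mul, Finset.abs_prod]
  simp only [abs_pow, abs_neg, abs_one, one_pow, Finset.prod_const_one, one_mul]
  rw [abs_of_nonneg (by positivity), inv_eq_one_div]
  have := radNorm_pos (Finset.univ.biUnion A)
  gcongr

open scoped Classical in
-- At most `2^(s|U|)` tuples have union `U`, and that weight keeps the sum over `U` convergent.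
lemma summable_radNorm_biUnion_rpow {σ : ℝ} (hσ : 1 < σ) :
    Summable fun A : Fin s → Finset (HeightOneSpectrum (𝓞 K)) =>
      radNorm (Finset.univ.biUnion A) ^ (-σ) := by
  have hs := summable_pow_card_mul_radNorm_rpow (K := K) hσ (c := 2 ^ s) (by positivity)
  have hpos : ∀ U : Finset (HeightOneSpectrum (𝓞 K)), 0 ≤ radNorm U ^ (-σ) := fun U =>
    Real.rpow_nonneg (radNorm_pos U).le _
  refine summable_of_sum_le (fun A => hpos _) (c := ∑' U, (2 ^ s : ℝ) ^ Finset.card U *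
    radNorm (K := K) U ^ (-σ)) fun T => ?_
  refine (Finset.sum_comp (s := T) (fun U => radNorm U ^ (-σ))
    (fun A => Finset.univ.biUnion A)).trans_le ?_
  refine le_trans (Finset.sum_le_sum fun U _ => ?_)
    (hs.sum_le_tsum _ fun U _ => mul_nonneg (by positivity) (hpos U))
  rw [nsmul_eq_mul]
  refine mul_le_mul_of_nonneg_right ?_ (hpos U)
  have : (T.filter fun A => Finset.univ.biUnion A = U) ⊆
      Fintype.piFinset fun _ : Fin s => U.powerset := by
    intro A hA
    rw [Fintype.mem_piFinset]
    intro i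
    rw [Finset.mem_powerset, ← (Finset.mem_filter.1 hA).2]
    exact Finset.subset_biUnion_of_mem A (Finset.mem_univ i)
  have h2 := Finset.card_le_card this
  rw [Fintype.card_piFinset_const, Finset.card_powerset] at h2
  rw [← pow_mul, mul_comm s, pow_mul]
  exact_mod_cast h2

variable {k}

lemma summable_radTerm (hk : 2 ≤ k) (hb : b ≠ ⊥) : Summable (radTerm k b a) := by
  classical
  refine Summable.of_norm_bounded (summable_radNorm_biUnion_rpow (σ := 2) (by norm_num))
    fun A => ?_
  rw [Real.norm_eq_abs]
  refine (abs_radTerm_le k b a hb A).trans ?_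
  have := radNorm_pos (Finset.univ.biUnion A)
  rw [Real.rpow_neg this.le, Real.rpow_two]
  gcongr
  exact one_le_radNorm _

lemma radTuple_injective : Function.Injective
    fun (A : Fin s → Finset (HeightOneSpectrum (𝓞 K))) (i : Fin s) =>
      (⟨rad (A i), rad_ne_bot (A i)⟩ : {I : Ideal (𝓞 K) // I ≠ ⊥}) := by
  intro A B h
  funext i
  exact rad_injective (congrArg Subtype.val (congrFun h i))

lemma STerm_eq_zero_of_notMem_range (n : Fin s → {I : Ideal (𝓞 K) // I ≠ ⊥})
    (hn : n ∉ Set.range fun (A : Fin s → Finset (HeightOneSpectrum (𝓞 K))) (i : Fin s) =>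
      (⟨rad (A i), rad_ne_bot (A i)⟩ : {I : Ideal (𝓞 K) // I ≠ ⊥})) :
    STerm k b a n = 0 := by
  by_cases h : ∀ i, Squarefree (n i : Ideal (𝓞 K))
  · choose A hA using fun i => exists_rad_eq_of_squarefree (n i).2 (h i)
    exact absurd ⟨A, funext fun i => Subtype.ext (hA i)⟩ hn
  · push Not at h
    obtain ⟨i, hi⟩ := h
    have h0 : ∏ i, (UniqueFactorizationMonoid.moebius (n i : Ideal (𝓞 K)) : ℝ) = 0 :=
      Finset.prod_eq_zero (Finset.mem_univ i) (by
        rw [UniqueFactorizationMonoid.moebius_of_not_squarefree hi, Int.cast_zero])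
    rw [STerm, h0, zero_div, zero_mul]

lemma summable_STerm (hk : 2 ≤ k) (hb : b ≠ ⊥) : Summable (STerm k b a) :=
  (radTuple_injective.summable_iff (STerm_eq_zero_of_notMem_range b a)).1
    (summable_radTerm b a hk hb)

lemma tsum_radTerm : ∑' A, radTerm k b a A = S k b a :=
  radTuple_injective.tsum_eq (f := STerm k b a) fun n hn => by
    by_contra h
    exact hn (STerm_eq_zero_of_notMem_range b a n h)

lemma hasProd_eulerFactor (hk : 2 ≤ k) (hb : b ≠ ⊥) :
    HasProd (eulerFactor k b a) ((Ideal.absNorm b : ℝ) * S k b a) := by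
  have h := (summable_radTerm b a hk hb).hasSum
  rw [tsum_radTerm] at h
  -- The tuples of subsets of `P` exhaust all tuples as `P` grows, so the partial products are
  -- partial sums along a cofinal family.
  have hmono : Filter.Tendsto (fun P : Finset (HeightOneSpectrum (𝓞 K)) =>
      Fintype.piFinset fun _ : Fin s => P.powerset) Filter.atTop Filter.atTop := by
    classical
    refine Filter.tendsto_atTop_finset_of_monotone ?_ fun A => ?_
    · intro P P' h
      exact Fintype.piFinset_subset _ _ fun _ => Finset.powerset_mono.2 h
    · refine ⟨Finset.univ.biUnion A, Fintype.mem_piFinset.2 fun i => Finset.mem_powerset.2 ?_⟩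
      exact Finset.subset_biUnion_of_mem A (Finset.mem_univ i)
  have h2 := (Filter.Tendsto.comp h hmono).const_mul (Ideal.absNorm b : ℝ)
  exact h2.congr fun P => absNorm_mul_sum_radTerm k b a hb P

lemma hasProd_eulerFactor_subtype (hk : 2 ≤ k) (hb : b ≠ ⊥)
    (hobs : ¬ ∃ p : HeightOneSpectrum (𝓞 K), Obstructed k b a p) :
    HasProd (fun p : {p : HeightOneSpectrum (𝓞 K) // ¬ b ≤ p.asIdeal ^ k} => eulerFactor k b a p)
      ((Ideal.absNorm b : ℝ) * S k b a) := by
  refine (hasProd_subtype_iff_of_mulSupport_subset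
    (s := {p : HeightOneSpectrum (𝓞 K) | ¬ b ≤ p.asIdeal ^ k}) ?_).2 (hasProd_eulerFactor b a hk hb)
  intro p hp h
  exact hp (eulerFactor_eq_one_of_le k b a h fun h' => hobs ⟨p, h'⟩)

lemma summable_eulerFactor_sub_one (hk : 2 ≤ k) (hb : b ≠ ⊥) :
    Summable fun p : HeightOneSpectrum (𝓞 K) => eulerFactor k b a p - 1 := by
  refine Summable.of_norm_bounded ((summable_absNorm_rpow (K := K) (σ := 2) (by norm_num)).mul_left
    ((Ideal.absNorm b : ℝ) * s)) fun p => ?_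
  have h1 : (Ideal.absNorm (p.asIdeal ^ k ⊔ b) : ℝ) ≤ Ideal.absNorm b := by
    exact_mod_cast Nat.le_of_dvd (absNorm_pos hb) (Ideal.absNorm_dvd_absNorm_of_le le_sup_right)
  have h2 : (D (p.asIdeal ^ k) b a : ℝ) ≤ s := by exact_mod_cast D_le b a _
  have h3 := two_le_absNorm_real p
  rw [Real.rpow_neg (by linarith), Real.rpow_two, ← div_eq_mul_inv, eulerFactor, sub_sub_cancel_left,
    norm_neg, Real.norm_of_nonneg (by positivity), map_pow, Nat.cast_pow]
  gcongr
  linarith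

lemma S_pos (hk : 2 ≤ k) (hb : b ≠ ⊥)
    (hobs : ¬ ∃ p : HeightOneSpectrum (𝓞 K), Obstructed k b a p) : 0 < S k b a := by
  have hpos : ∀ p, 0 < eulerFactor k b a p := fun p =>
    lt_of_le_of_ne (eulerFactor_nonneg k b a p) fun h =>
      hobs ⟨p, (obstructed_iff_eulerFactor_eq_zero k b a p).2 h.symm⟩
  have h1 := Real.summable_log_one_add_of_summable (summable_eulerFactor_sub_one b a hk hb)
  simp only [add_sub_cancel] at h1
  have h2 := Real.hasProd_of_hasSum_log hpos h1.hasSum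
  have h3 := h2.unique (hasProd_eulerFactor b a hk hb)
  have h4 : 0 < (Ideal.absNorm b : ℝ) * S k b a := h3 ▸ Real.exp_pos _
  exact pos_of_mul_pos_right h4 (Nat.cast_nonneg _)

lemma S_le_one (hk : 2 ≤ k) (hb : b ≠ ⊥) : S k b a ≤ 1 := by
  have h : (Ideal.absNorm b : ℝ) * S k b a ≤ 1 :=
    le_of_tendsto' (hasProd_eulerFactor b a hk hb) fun P =>
      Finset.prod_le_one (fun p _ => eulerFactor_nonneg k b a p) fun p _ => eulerFactor_le_one k b a p
  have h1 : (1 : ℝ) ≤ Ideal.absNorm b := by exact_mod_cast absNorm_pos hb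
  nlinarith

lemma kfree_eq_zero_of_mem {c : 𝓞 K} {p : HeightOneSpectrum (𝓞 K)} (h : c ∈ p.asIdeal ^ k) :
    kfree k c = 0 := by
  rw [kfree, kfreeIdeal, if_neg]
  intro hp
  exact hp p ((Ideal.span_singleton_le_iff_mem _).2 h)

lemma kfree_le_one (c : 𝓞 K) : kfree k c ≤ 1 := by
  rw [kfree, kfreeIdeal]; split_ifs <;> simp

lemma M_eq_zero_of_obstructed {d : ℕ} (e : Module.Basis (Fin d) ℤ (𝓞 K))
    {p : HeightOneSpectrum (𝓞 K)} (hp : Obstructed k b a p) (x : ℝ) : M e k x b a = 0 := by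
  classical
  have h1 := (obstructed_iff_eulerFactor_eq_zero k b a p).1 hp
  have hfin := finite_quotient (pow_ne_bot k p)
  rw [eulerFactor_eq_div, div_eq_zero_iff] at h1
  have h2 := ncard_goodClasses_elim0_pos k b (pow_ne_bot k p) {p}
  have h3 : (goodClasses k b a (p.asIdeal ^ k) {p}).ncard = 0 := by
    rcases h1 with h | h
    · exact_mod_cast h
    · exact absurd (by exact_mod_cast h) h2.ne'
  rw [Set.ncard_eq_zero, Set.eq_empty_iff_forall_notMem] at h3
  rw [M]
  refine Finset.sum_eq_zero fun c hc => ?_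
  have hcb : c ∈ b := (Finset.mem_filter.1 hc).2
  have h4 := h3 (Ideal.Quotient.mk _ c)
  have h5 : ∃ i, c + a i ∈ p.asIdeal ^ k := by
    by_contra h
    push Not at h
    exact h4 ⟨c, hcb, rfl, fun q hq i => by rw [Finset.mem_singleton.1 hq]; exact h i⟩
  obtain ⟨i, hi⟩ := h5
  exact Finset.prod_eq_zero (Finset.mem_univ i) (kfree_eq_zero_of_mem hi)

/-- The tail of the singular series over tuples having a component of large norm. -/
lemma exists_abs_S_sub_sum_radTerm_le (K : Type*) [Field K] [NumberField K] (s : ℕ) {ε : ℝ}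
    (hε : 0 < ε) (hε1 : ε ≤ 1) :
    ∃ C : ℝ, 0 ≤ C ∧ ∀ k : ℕ, 2 ≤ k → ∀ b : Ideal (𝓞 K), b ≠ ⊥ → ∀ (a : Fin s → 𝓞 K) (y : ℝ),
      1 ≤ y →
      |S k b a - ∑ A ∈ Fintype.piFinset fun _ => (finite_radNorm_le (K := K) y).toFinset,
        radTerm k b a A| ≤ C * y ^ (-((k : ℝ) - 1 - ε)) := by
  classical
  have hg := summable_radNorm_biUnion_rpow (K := K) (s := s) (σ := 1 + ε) (by linarith)
  have hg0 : ∀ A : Fin s → Finset (HeightOneSpectrum (𝓞 K)),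
      0 ≤ radNorm (Finset.univ.biUnion A) ^ (-(1 + ε)) := fun A =>
    Real.rpow_nonneg (radNorm_pos _).le _
  refine ⟨∑' A : Fin s → Finset (HeightOneSpectrum (𝓞 K)),
    radNorm (Finset.univ.biUnion A) ^ (-(1 + ε)), tsum_nonneg hg0, fun k hk b hb a y hy => ?_⟩
  set F := Fintype.piFinset fun _ : Fin s => (finite_radNorm_le (K := K) y).toFinset with hF
  have hsum := summable_radTerm b a hk hb
  have h1 : HasSum (fun A : {A // A ∉ F} => radTerm k b a A)
      (S k b a - ∑ A ∈ F, radTerm k b a A) := by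
    have := (hsum.subtype {A | A ∉ F}).hasSum
    rw [← tsum_radTerm b a, ← hsum.sum_add_tsum_subtype_compl F, add_sub_cancel_left]
    exact this
  rw [← h1.tsum_eq, ← Real.norm_eq_abs]
  have hy0 : 0 < y := by linarith
  have hkε : 0 ≤ (k : ℝ) - 1 - ε := by
    have : (2 : ℝ) ≤ k := by exact_mod_cast hk
    linarith
  refine (tsum_of_norm_bounded ((hg.subtype {A | A ∉ F}).hasSum.mul_right
    (y ^ (-((k : ℝ) - 1 - ε)))) fun A => ?_).trans ?_
  · rw [Real.norm_eq_abs]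
    refine (abs_radTerm_le k b a hb A.1).trans ?_
    have hpos := radNorm_pos (Finset.univ.biUnion A.1)
    have hlt : y < radNorm (Finset.univ.biUnion A.1) := by
      have h2 := A.2
      simp only [hF, Fintype.mem_piFinset, Set.Finite.mem_toFinset, Set.mem_ofPred_eq, not_forall,
        not_le] at h2
      obtain ⟨i, hi⟩ := h2
      exact hi.trans_le (radNorm_mono (Finset.subset_biUnion_of_mem A.1 (Finset.mem_univ i)))
    -- Splitting `k = (1 + ε) + (k - 1 - ε)` leaves a convergent sum independent of `k`; the second
    -- part supplies the decay, as the union has norm above `y`.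
    have e : (radNorm (Finset.univ.biUnion A.1) ^ k)⁻¹ =
        radNorm (Finset.univ.biUnion A.1) ^ (-(1 + ε)) *
          radNorm (Finset.univ.biUnion A.1) ^ (-((k : ℝ) - 1 - ε)) := by
      rw [← Real.rpow_add hpos, ← Real.rpow_natCast, ← Real.rpow_neg hpos.le]
      congr 1; ring
    rw [e]
    refine mul_le_mul_of_nonneg_left ?_ (hg0 A.1)
    exact Real.rpow_le_rpow_of_nonpos hy0 hlt.le (by linarith)
  · refine mul_le_mul_of_nonneg_right ?_ (by positivity)
    exact Summable.tsum_subtype_le _ _ hg0 hg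

end Series

/-! ### The truncated sieve -/

section Sieve

variable {K : Type*} [Field K] [NumberField K]

open scoped Classical in
/-- The truncation to squarefree ideals of norm at most `y` of the Möbius expansion of the
indicator of `k`-free elements. -/
noncomputable def truncSum (y : ℝ) (k : ℕ) (c : 𝓞 K) : ℝ :=
  ∑ A ∈ (finite_radNorm_le (K := K) y).toFinset,
    (-1 : ℝ) ^ A.card * if c ∈ rad A ^ k then 1 else 0

lemma abs_truncSum_le (y : ℝ) (k : ℕ) (c : 𝓞 K) :
    |truncSum y k c| ≤ (finite_radNorm_le (K := K) y).toFinset.card := by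
  classical
  rw [truncSum, Finset.card_eq_sum_ones]
  push_cast
  refine (Finset.abs_sum_le_sum_abs _ _).trans (Finset.sum_le_sum fun A _ => ?_)
  split_ifs <;> simp

lemma exists_primes_pow_dvd {k : ℕ} (hk : k ≠ 0) {c : 𝓞 K} (hc : c ≠ 0) :
    ∃ B : Finset (HeightOneSpectrum (𝓞 K)), ∀ p, p ∈ B ↔ c ∈ p.asIdeal ^ k := by
  have h : {p : HeightOneSpectrum (𝓞 K) | c ∈ p.asIdeal ^ k}.Finite := by
    have hI : Ideal.span {c} ≠ 0 := by simpa using hc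
    refine (Ideal.finite_factors hI).subset fun p hp => ?_
    rw [Set.mem_ofPred_eq, Ideal.dvd_span_singleton]
    exact Ideal.pow_le_self hk hp
  exact ⟨h.toFinset, fun p => by simp⟩

section

variable {k : ℕ} {c : 𝓞 K} {B : Finset (HeightOneSpectrum (𝓞 K))}
  (hB : ∀ p, p ∈ B ↔ c ∈ p.asIdeal ^ k)

include hB

lemma mem_rad_pow_iff_subset (A : Finset (HeightOneSpectrum (𝓞 K))) :
    c ∈ rad A ^ k ↔ A ⊆ B := by
  rw [mem_rad_pow, Finset.subset_iff]
  exact forall₂_congr fun p _ => (hB p).symm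

lemma abs_truncSum_le_two_pow (y : ℝ) : |truncSum y k c| ≤ 2 ^ B.card := by
  classical
  rw [truncSum]
  simp only [mul_ite, mul_one, mul_zero, mem_rad_pow_iff_subset hB]
  rw [← Finset.sum_filter]
  refine (Finset.abs_sum_le_sum_abs _ _).trans ?_
  simp only [abs_pow, abs_neg, abs_one, one_pow, Finset.sum_const, nsmul_eq_mul, mul_one]
  have : (Finset.filter (fun A => A ⊆ B) (finite_radNorm_le (K := K) y).toFinset) ⊆ B.powerset :=
    fun A hA => Finset.mem_powerset.2 (Finset.mem_filter.1 hA).2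
  have h2 := Finset.card_le_card this
  rw [Finset.card_powerset] at h2
  exact_mod_cast h2

lemma truncSum_eq_kfree {y : ℝ} (hy : radNorm B ≤ y) : truncSum y k c = kfree k c := by
  classical
  have h1 : truncSum y k c = ∑ A ∈ B.powerset, (-1 : ℝ) ^ A.card * if c ∈ rad A ^ k then 1 else 0 := by
    rw [truncSum]
    symm
    refine Finset.sum_subset (fun A hA => ?_) fun A _ hA => ?_
    · exact (finite_radNorm_le y).mem_toFinset.2 ((radNorm_mono (Finset.mem_powerset.1 hA)).trans hy)
    · rw [if_neg, mul_zero]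
      rw [mem_rad_pow_iff_subset hB]
      exact fun h => hA (Finset.mem_powerset.2 h)
  rw [h1, sum_powerset_indicator_rad_pow, kfree, kfreeIdeal]
  have h2 : (∀ p ∈ B, c ∉ p.asIdeal ^ k) ↔
      ∀ p : HeightOneSpectrum (𝓞 K), ¬ Ideal.span {c} ≤ p.asIdeal ^ k := by
    simp only [Ideal.span_singleton_le_iff_mem]
    exact ⟨fun h p hp => h p ((hB p).2 hp) hp, fun h p _ => h p⟩
  by_cases h : ∀ p ∈ B, c ∉ p.asIdeal ^ k
  · rw [if_pos h, if_pos (h2.1 h), Nat.cast_one]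
  · rw [if_neg h, if_neg (mt h2.2 h), Nat.cast_zero]

end

variable {d : ℕ} (e : Module.Basis (Fin d) ℤ (𝓞 K))

/-- If `B` is the set of primes with `c ∈ p ^ k`, then `N(rad B) ≤ N(rad B ^ k)`, which is `O(x^d)`
since `c` is a nonzero element of `rad B ^ k`. The divisor bound applies to `2^|B|`, uniformly in
`k` and `y`. -/
lemma exists_abs_truncSum_le {ε : ℝ} (hε : 0 < ε) : ∃ C : ℝ, 1 ≤ C ∧ ∀ k : ℕ, k ≠ 0 →
    ∀ c : 𝓞 K, c ≠ 0 → ∀ x : ℝ, 1 ≤ x → (geomNorm e c : ℝ) ≤ 2 * x → ∀ y : ℝ,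
      |truncSum y k c| ≤ C * x ^ ε := by
  have hd : 0 < d := by rw [← finrank_eq_of_basis e]; exact Module.finrank_pos
  obtain ⟨C0, hC0, h0⟩ := exists_absNorm_le e
  obtain ⟨C1, hC1, h1⟩ := exists_two_pow_card_le (K := K) (ε := ε / d) (by positivity)
  refine ⟨max 1 (C1 * (C0 * 2 ^ d) ^ (ε / d)), le_max_left _ _, fun k hk c hc x hx hcx y => ?_⟩
  obtain ⟨B, hB⟩ := exists_primes_pow_dvd hk hc
  have hgn : (0 : ℝ) ≤ geomNorm e c := by exact_mod_cast geomNorm_nonneg e c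
  have hr : radNorm B ≤ C0 * 2 ^ d * x ^ d := by
    have h2 := h0 (rad B ^ k) c ((mem_rad_pow_iff_subset hB B).2 subset_rfl) hc
    rw [map_pow, Nat.cast_pow, absNorm_rad] at h2
    calc radNorm B ≤ radNorm B ^ k := le_self_pow₀ (one_le_radNorm B) hk
      _ ≤ C0 * (geomNorm e c : ℝ) ^ d := h2
      _ ≤ C0 * (2 * x) ^ d := by gcongr
      _ = _ := by rw [mul_pow]; ring
  have hx0 : 0 < x := by linarith
  calc |truncSum y k c| ≤ 2 ^ B.card := abs_truncSum_le_two_pow hB y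
    _ ≤ C1 * radNorm B ^ (ε / d) := h1 B
    _ ≤ C1 * (C0 * 2 ^ d * x ^ d) ^ (ε / d) := by
        have := radNorm_pos B
        gcongr
    _ = C1 * (C0 * 2 ^ d) ^ (ε / d) * x ^ ε := by
        rw [Real.mul_rpow (by positivity) (by positivity), ← Real.rpow_natCast, ← Real.rpow_natCast,
          ← Real.rpow_mul hx0.le, mul_div_cancel₀ _ (by positivity), mul_assoc]
    _ ≤ _ := by gcongr; exact le_max_right _ _

/-- The nonzero elements of a ball that are divisible by the `k`-th power of a squarefree ideal of
norm exceeding `y`. -/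
def badSet (k : ℕ) (x y : ℝ) : Set (𝓞 K) :=
  {c | c ≠ 0 ∧ c ∈ ball e x ∧ ∃ A : Finset (HeightOneSpectrum (𝓞 K)), y < radNorm A ∧ c ∈ rad A ^ k}

lemma finite_badSet (k : ℕ) (x y : ℝ) : (badSet e k x y).Finite :=
  (ball_finite e x).subset fun _ h => h.2.1

lemma exists_ncard_badSet_le {ε : ℝ} (hε : 0 < ε) (hε1 : ε ≤ 1) : ∃ C : ℝ, 0 ≤ C ∧
    ∀ k : ℕ, 2 ≤ k → ∀ x y : ℝ, 0 ≤ x → 1 ≤ y →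
      ((badSet e k x y).ncard : ℝ) ≤ C * x ^ d * y ^ (-((k : ℝ) - 1 - ε)) := by
  classical
  obtain ⟨C, hC, h⟩ := exists_ncard_ideal_ne_zero_le e
  have hs := summable_pow_card_mul_radNorm_rpow (K := K) (σ := 1 + ε) (by linarith) (c := 1)
    (by norm_num)
  simp only [one_pow, one_mul] at hs
  have hpos : ∀ A : Finset (HeightOneSpectrum (𝓞 K)), 0 ≤ radNorm A ^ (-(1 + ε)) := fun A =>
    Real.rpow_nonneg (radNorm_pos A).le _
  refine ⟨C * ∑' A : Finset (HeightOneSpectrum (𝓞 K)), radNorm A ^ (-(1 + ε)),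
    mul_nonneg hC (tsum_nonneg hpos), fun k hk x y hx hy => ?_⟩
  have hkε : 0 ≤ (k : ℝ) - 1 - ε := by
    have : (2 : ℝ) ≤ k := by exact_mod_cast hk
    linarith
  have hy0 : 0 < y := by linarith
  set Z := (finite_badSet e k x y).toFinset with hZ
  have hZmem : ∀ c, c ∈ Z ↔ c ∈ badSet e k x y := fun c => (finite_badSet e k x y).mem_toFinset
  -- Each bad element is charged to one chosen witness `A`; the fibre over `A` consists of small
  -- nonzero elements of `rad A ^ k`.
  let f : 𝓞 K → Finset (HeightOneSpectrum (𝓞 K)) := fun c =>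
    if hc : c ∈ badSet e k x y then hc.2.2.choose else ∅
  have hf : ∀ c ∈ badSet e k x y, y < radNorm (f c) ∧ c ∈ rad (f c) ^ k := by
    intro c hc
    simp only [f, dif_pos hc]
    exact hc.2.2.choose_spec
  have hfib : ∀ A ∈ Z.image f, ((Z.filter fun c => f c = A).card : ℝ) ≤
      C * x ^ d * (y ^ (-((k : ℝ) - 1 - ε)) * radNorm A ^ (-(1 + ε))) := by
    intro A hA
    obtain ⟨c0, hc0, rfl⟩ := Finset.mem_image.1 hA
    have hy1 := (hf c0 ((hZmem c0).1 hc0)).1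
    have hpos' := radNorm_pos (f c0)
    have hsub : ((Z.filter fun c => f c = f c0 : Finset (𝓞 K)) : Set (𝓞 K)) ⊆
        {c : 𝓞 K | c ∈ rad (f c0) ^ k ∧ c ≠ 0 ∧ c ∈ ball e x} := by
      intro c hc
      obtain ⟨h1, h2⟩ := Finset.mem_filter.1 (Finset.mem_coe.1 hc)
      have h3 := (hZmem c).1 h1
      exact ⟨h2 ▸ (hf c h3).2, h3.1, h3.2.1⟩
    have hle := Set.ncard_le_ncard hsub ((ball_finite e x).subset fun c hc => hc.2.2)
    rw [Set.ncard_coe_finset] at hle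
    have h4 := h (rad (f c0) ^ k) (pow_ne_zero k (rad_ne_bot _)) x hx
    rw [map_pow, Nat.cast_pow, absNorm_rad, div_eq_mul_inv] at h4
    refine le_trans (by exact_mod_cast hle) (h4.trans ?_)
    have e1 : (radNorm (f c0) ^ k)⁻¹ =
        radNorm (f c0) ^ (-((k : ℝ) - 1 - ε)) * radNorm (f c0) ^ (-(1 + ε)) := by
      rw [← Real.rpow_add hpos', ← Real.rpow_natCast, ← Real.rpow_neg hpos'.le]
      congr 1; ring
    rw [e1]
    refine mul_le_mul_of_nonneg_left (mul_le_mul_of_nonneg_right ?_ (hpos _)) (by positivity)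
    exact Real.rpow_le_rpow_of_nonpos hy0 hy1.le (by linarith)
  rw [Set.ncard_eq_toFinset_card _ (finite_badSet e k x y), ← hZ,
    Finset.card_eq_sum_card_image f Z]
  push_cast
  refine (Finset.sum_le_sum hfib).trans ?_
  rw [← Finset.mul_sum, ← Finset.mul_sum]
  calc _ ≤ C * x ^ d * (y ^ (-((k : ℝ) - 1 - ε)) *
        ∑' A : Finset (HeightOneSpectrum (𝓞 K)), radNorm A ^ (-(1 + ε))) := by
        gcongr
        exact hs.sum_le_tsum _ fun A _ => hpos A
    _ = _ := by ring

open scoped Classical in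
/-- The elements of `b` in the ball of radius `x`. -/
noncomputable def ballFinset (x : ℝ) (b : Ideal (𝓞 K)) : Finset (𝓞 K) :=
  {c ∈ (ball_finite e x).toFinset | c ∈ b}

lemma mem_ballFinset {x : ℝ} {b : Ideal (𝓞 K)} {c : 𝓞 K} :
    c ∈ ballFinset e x b ↔ c ∈ ball e x ∧ c ∈ b := by
  classical
  rw [ballFinset, Finset.mem_filter, Set.Finite.mem_toFinset]

lemma M_eq_sum (k : ℕ) (x : ℝ) (b : Ideal (𝓞 K)) {s : ℕ} (a : Fin s → 𝓞 K) :
    (M e k x b a : ℝ) = ∑ c ∈ ballFinset e x b, ∏ i, (kfree k (c + a i) : ℝ) := by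
  rw [M, ballFinset]
  push_cast
  rfl

lemma M_le_ncard_ball (k : ℕ) (x : ℝ) (b : Ideal (𝓞 K)) {s : ℕ} (a : Fin s → 𝓞 K) :
    M e k x b a ≤ (ball e x).ncard := by
  classical
  rw [M, Set.ncard_eq_toFinset_card _ (ball_finite e x)]
  calc _ ≤ ∑ c ∈ (ball_finite e x).toFinset with c ∈ b, 1 :=
        Finset.sum_le_sum fun c _ => Finset.prod_le_one' fun i _ => kfree_le_one _
    _ ≤ _ := by rw [← Finset.card_eq_sum_ones]; exact Finset.card_filter_le _ _

/-- For a fixed tuple the conditions on `c` define a single coset of the intersection of the ideals,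
or nothing when `E` vanishes. The coset count has an error independent of the tuple, so the total
error is the number of tuples times it. -/
lemma exists_abs_sum_prod_truncSum_sub_le (s : ℕ) : ∃ C : ℝ, 0 ≤ C ∧ ∀ k : ℕ, ∀ b : Ideal (𝓞 K),
    b ≠ ⊥ → ∀ (a : Fin s → 𝓞 K) (x y : ℝ), 1 ≤ x →
      |∑ c ∈ ballFinset e x b, ∏ i, truncSum y k (c + a i) -
        (∑ A ∈ Fintype.piFinset fun _ => (finite_radNorm_le (K := K) y).toFinset,
          radTerm k b a A) * (2 ^ d / d.factorial * x ^ d)| * x ≤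
        ((finite_radNorm_le (K := K) y).toFinset.card : ℝ) ^ s * (C * x ^ d) := by
  classical
  obtain ⟨C, hC, h⟩ := exists_ncard_idealBall e
  refine ⟨C, hC, fun k b hb a x y hx => ?_⟩
  set F := (finite_radNorm_le (K := K) y).toFinset
  have hx0 : 0 < x := by linarith
  have hexp : ∑ c ∈ ballFinset e x b, ∏ i, truncSum y k (c + a i) =
      ∑ A ∈ Fintype.piFinset fun _ : Fin s => F, (∏ i, (-1 : ℝ) ^ (A i).card) *
        ({c ∈ ballFinset e x b | ∀ i, c + a i ∈ rad (A i) ^ k}.card : ℝ) := by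
    simp only [truncSum, Finset.prod_univ_sum]
    rw [Finset.sum_comm]
    refine Finset.sum_congr rfl fun A _ => ?_
    rw [Finset.card_filter]
    push_cast
    rw [Finset.mul_sum]
    refine Finset.sum_congr rfl fun c _ => ?_
    rw [Finset.prod_mul_distrib, Finset.prod_boole]
    simp only [Finset.mem_univ, true_implies]
  have hterm : ∀ A : Fin s → Finset (HeightOneSpectrum (𝓞 K)),
      |({c ∈ ballFinset e x b | ∀ i, c + a i ∈ rad (A i) ^ k}.card : ℝ) -
        ((E b (fun i => rad (A i) ^ k) a : ℝ) / Ideal.absNorm (b ⊓ ⨅ i, rad (A i) ^ k)) *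
          (2 ^ d / d.factorial * x ^ d)| * x ≤ C * x ^ d := by
    intro A
    rw [E]
    split_ifs with hE
    · obtain ⟨t, htb, ht⟩ := hE
      have h1 := h _ (inf_iInf_rad_pow_ne_bot k b hb A) (t) x hx
      have h2 : (({c ∈ ballFinset e x b | ∀ i, c + a i ∈ rad (A i) ^ k} : Finset (𝓞 K)) :
          Set (𝓞 K)) = idealBall e (b ⊓ ⨅ i, rad (A i) ^ k) t x := by
        ext c
        rw [Finset.mem_coe, Finset.mem_filter, mem_ballFinset, idealBall, Set.mem_ofPred_eq,
          Submodule.mem_inf, Submodule.mem_iInf, Submodule.sub_mem_iff_left _ htb]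
        have h3 : ∀ i, c - t ∈ rad (A i) ^ k ↔ c + a i ∈ rad (A i) ^ k := by
          intro i
          have h4 : c - t = (c + a i) - (t + a i) := by ring
          rw [h4]
          exact Submodule.sub_mem_iff_left _ (ht i)
        simp only [h3]
        tauto
      rw [← h2, Set.ncard_coe_finset] at h1
      convert h1 using 4
      push_cast
      ring
    · have h2 : ({c ∈ ballFinset e x b | ∀ i, c + a i ∈ rad (A i) ^ k} : Finset (𝓞 K)) = ∅ := by
        rw [Finset.eq_empty_iff_forall_notMem]
        intro c hc
        obtain ⟨h3, h4⟩ := Finset.mem_filter.1 hc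
        exact hE ⟨c, ((mem_ballFinset e).1 h3).2, h4⟩
      rw [h2]
      simp only [Finset.card_empty, Nat.cast_zero, zero_div, zero_mul, sub_zero, abs_zero]
      positivity
  rw [hexp, Finset.sum_mul, ← Finset.sum_sub_distrib]
  calc _ ≤ (∑ A ∈ Fintype.piFinset fun _ : Fin s => F, |(∏ i, (-1 : ℝ) ^ (A i).card) *
        ({c ∈ ballFinset e x b | ∀ i, c + a i ∈ rad (A i) ^ k}.card : ℝ) -
          radTerm k b a A * (2 ^ d / d.factorial * x ^ d)|) * x := by
        gcongr; exact Finset.abs_sum_le_sum_abs _ _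
    _ ≤ ∑ A ∈ Fintype.piFinset fun _ : Fin s => F, C * x ^ d := by
        rw [Finset.sum_mul]
        refine Finset.sum_le_sum fun A _ => ?_
        rw [radTerm_eq, mul_assoc, ← mul_sub, abs_mul, Finset.abs_prod]
        simp only [abs_pow, abs_neg, abs_one, one_pow, Finset.prod_const_one, one_mul]
        exact hterm A
    _ = _ := by
        rw [Finset.sum_const, Fintype.card_piFinset_const, nsmul_eq_mul, Nat.cast_pow]

end Sieve

/-! ### The asymptotic formula with uniform constants -/

section Asymptotic

variable {K : Type*} [Field K] [NumberField K] {d : ℕ} (e : Module.Basis (Fin d) ℤ (𝓞 K))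

lemma abs_prod_kfree_le_one {k s : ℕ} (c : Fin s → 𝓞 K) :
    |∏ i, (kfree k (c i) : ℝ)| ≤ 1 := by
  rw [abs_of_nonneg (Finset.prod_nonneg fun _ _ => Nat.cast_nonneg _)]
  exact Finset.prod_le_one (fun _ _ => Nat.cast_nonneg _) fun i _ => by
    exact_mod_cast kfree_le_one (c i)

/-- The truncation error at a single point. -/
lemma abs_prod_kfree_sub_prod_truncSum_le {k s : ℕ} (hk : k ≠ 0) {x y T : ℝ} (hT : 1 ≤ T)
    (c : Fin s → 𝓞 K) (hc : ∀ i, c i ∈ ball e (2 * x))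
    (hcT : ∀ i, c i ≠ 0 → |truncSum y k (c i)| ≤ T)
    [DecidablePred fun i => c i = 0] [DecidablePred fun i => c i ∈ badSet e k (2 * x) y] :
    |∏ i, (kfree k (c i) : ℝ) - ∏ i, truncSum y k (c i)| ≤
      ∑ i, (if c i = 0 then 1 + ((finite_radNorm_le (K := K) y).toFinset.card : ℝ) ^ s else 0) +
      ∑ i, if c i ∈ badSet e k (2 * x) y then 1 + T ^ s else 0 := by
  set F := (finite_radNorm_le (K := K) y).toFinset
  have hs1 : 0 ≤ ∑ i, (if c i = 0 then 1 + (F.card : ℝ) ^ s else 0) :=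
    Finset.sum_nonneg fun i _ => by split_ifs <;> positivity
  have hs2 : 0 ≤ ∑ i, if c i ∈ badSet e k (2 * x) y then 1 + T ^ s else 0 :=
    Finset.sum_nonneg fun i _ => by split_ifs <;> positivity
  have hbound : ∀ R : ℝ, (∀ i, |truncSum y k (c i)| ≤ R) →
      |∏ i, (kfree k (c i) : ℝ) - ∏ i, truncSum y k (c i)| ≤ 1 + R ^ s := by
    intro R hR
    refine (abs_sub _ _).trans (add_le_add (abs_prod_kfree_le_one c) ?_)
    rw [Finset.abs_prod]
    refine (Finset.prod_le_prod (fun i _ => abs_nonneg _) fun i _ => hR i).trans_eq ?_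
    rw [Finset.prod_const, Finset.card_univ, Fintype.card_fin]
  by_cases h0 : ∃ i, c i = 0
  · obtain ⟨i, hi⟩ := h0
    -- At a zero argument the divisor bound is unavailable, so the trivial bound is used for every
    -- factor; such points are rare enough to afford it.
    have h1 := hbound F.card fun i => abs_truncSum_le y k (c i)
    have h2 := Finset.single_le_sum (f := fun i => if c i = 0 then 1 + (F.card : ℝ) ^ s else 0)
      (fun i _ => by positivity) (Finset.mem_univ i)
    simp only [if_pos hi] at h2
    linarith
  · push Not at h0
    by_cases hbad : ∃ i, c i ∈ badSet e k (2 * x) y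
    · obtain ⟨i, hi⟩ := hbad
      have h1 := hbound T fun i => hcT i (h0 i)
      have h2 := Finset.single_le_sum
        (f := fun i => if c i ∈ badSet e k (2 * x) y then 1 + T ^ s else 0)
        (fun i _ => by positivity) (Finset.mem_univ i)
      simp only [if_pos hi] at h2
      linarith
    · push Not at hbad
      -- A nonzero argument outside the bad set has its whole prime set `B` of norm at most `y`, so
      -- the truncation loses nothing.
      have h1 : ∀ i, truncSum y k (c i) = kfree k (c i) := by
        intro i
        obtain ⟨B, hB⟩ := exists_primes_pow_dvd hk (h0 i)
        refine truncSum_eq_kfree hB ?_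
        by_contra hlt
        exact hbad i ⟨h0 i, hc i, B, not_le.1 hlt, (mem_rad_pow_iff_subset hB B).2 subset_rfl⟩
      simp only [h1, sub_self, abs_zero]
      linarith

/-- Translation by `a i` is injective, so each `i` accounts for at most one zero argument and at
most as many bad points as `badSet` has. The translates lie in the ball of radius `2x`. -/
lemma abs_M_sub_sum_prod_truncSum_le {k s : ℕ} (hk : k ≠ 0) {x y T : ℝ} (hT : 1 ≤ T)
    (hcT : ∀ c : 𝓞 K, c ≠ 0 → c ∈ ball e (2 * x) → |truncSum y k c| ≤ T)
    (b : Ideal (𝓞 K)) (a : Fin s → 𝓞 K) (ha : ∀ i, (geomNorm e (a i) : ℝ) ≤ x) :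
    |(M e k x b a : ℝ) - ∑ c ∈ ballFinset e x b, ∏ i, truncSum y k (c + a i)| ≤
      s * (1 + ((finite_radNorm_le (K := K) y).toFinset.card : ℝ) ^ s) +
      s * ((badSet e k (2 * x) y).ncard * (1 + T ^ s)) := by
  classical
  set F := (finite_radNorm_le (K := K) y).toFinset
  have hball : ∀ c ∈ ballFinset e x b, ∀ i, c + a i ∈ ball e (2 * x) := by
    intro c hc i
    have h1 : (geomNorm e c : ℝ) ≤ x := ((mem_ballFinset e).1 hc).1
    have h2 : (geomNorm e (c + a i) : ℝ) ≤ geomNorm e c + geomNorm e (a i) := by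
      exact_mod_cast geomNorm_add_le e c (a i)
    have h3 := ha i
    change (geomNorm e (c + a i) : ℝ) ≤ 2 * x
    linarith
  rw [M_eq_sum, ← Finset.sum_sub_distrib]
  refine (Finset.abs_sum_le_sum_abs _ _).trans ?_
  refine (Finset.sum_le_sum fun c hc => abs_prod_kfree_sub_prod_truncSum_le e hk hT
    (fun i => c + a i) (hball c hc) fun i h0 => hcT _ h0 (hball c hc i)).trans ?_
  rw [Finset.sum_add_distrib, Finset.sum_comm (s := ballFinset e x b),
    Finset.sum_comm (s := ballFinset e x b)]
  refine add_le_add ?_ ?_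
  · have h1 : ∀ i ∈ (Finset.univ : Finset (Fin s)), (∑ c ∈ ballFinset e x b,
        if c + a i = 0 then 1 + (F.card : ℝ) ^ s else 0) ≤ 1 + (F.card : ℝ) ^ s := by
      intro i _
      rw [← Finset.sum_filter, Finset.sum_const, nsmul_eq_mul]
      refine mul_le_of_le_one_left (by positivity) ?_
      have : (Finset.filter (fun c => c + a i = 0) (ballFinset e x b)).card ≤ 1 := by
        refine Finset.card_le_one.2 fun c hc c' hc' => ?_
        exact add_right_cancel ((Finset.mem_filter.1 hc).2.trans (Finset.mem_filter.1 hc').2.symm)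
      exact_mod_cast this
    refine (Finset.sum_le_sum h1).trans_eq ?_
    rw [Finset.sum_const, Finset.card_univ, Fintype.card_fin, nsmul_eq_mul]
  · have h1 : ∀ i ∈ (Finset.univ : Finset (Fin s)), (∑ c ∈ ballFinset e x b,
        if c + a i ∈ badSet e k (2 * x) y then 1 + T ^ s else 0) ≤
          (badSet e k (2 * x) y).ncard * (1 + T ^ s) := by
      intro i _
      rw [← Finset.sum_filter, Finset.sum_const, nsmul_eq_mul]
      refine mul_le_mul_of_nonneg_right ?_ (by positivity)
      rw [← Set.ncard_coe_finset]
      exact_mod_cast Set.ncard_le_ncard_of_injOn (fun c => c + a i)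
        (fun c hc => (Finset.mem_filter.1 (Finset.mem_coe.1 hc)).2)
        (add_left_injective (a i)).injOn (finite_badSet e k (2 * x) y)
    refine (Finset.sum_le_sum h1).trans_eq ?_
    rw [Finset.sum_const, Finset.card_univ, Fintype.card_fin, nsmul_eq_mul]

lemma exists_abs_M_sub_le_of_card (s : ℕ) {η : ℝ} (hη : 0 < η) : ∃ C : ℝ, 0 ≤ C ∧
    ∀ k : ℕ, 2 ≤ k → ∀ b : Ideal (𝓞 K), b ≠ ⊥ → ∀ (a : Fin s → 𝓞 K) (x : ℝ), 1 ≤ x →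
      (∀ i, (geomNorm e (a i) : ℝ) ≤ x) →
        |(M e k x b a : ℝ) - S k b a * (2 ^ d / d.factorial * x ^ d)| ≤
          C * x ^ ((d : ℝ) - ((k : ℝ) - 1) / ((k : ℝ) + 2 * (s : ℝ) * (k : ℝ) - 1) + η) := by
  have hd : 0 < d := by rw [← finrank_eq_of_basis e]; exact Module.finrank_pos
  have hdR : (1 : ℝ) ≤ d := by exact_mod_cast hd
  -- `ε₁` pays for convergence of the tails, and `ε₂` for the divisor bound, used `s` times; each
  -- total is at most `η / 2`.
  set ε₁ := min 1 (η / 2) with hε₁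
  have hε₁0 : 0 < ε₁ := by positivity
  have hε₁1 : ε₁ ≤ 1 := min_le_left _ _
  have hε₁η : ε₁ ≤ η / 2 := min_le_right _ _
  set ε₂ := η / (2 * (s + 1)) with hε₂
  have hε₂0 : 0 < ε₂ := by positivity
  have hsε₂ : s * ε₂ ≤ η / 2 := by
    rw [hε₂, mul_div_assoc', div_le_div_iff₀ (by positivity) (by positivity)]
    nlinarith
  obtain ⟨C₁, hC₁, h₁⟩ := exists_card_radNorm_le (K := K)
  obtain ⟨C₂, hC₂, h₂⟩ := exists_abs_sum_prod_truncSum_sub_le e s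
  obtain ⟨C₃, hC₃, h₃⟩ := exists_abs_truncSum_le e hε₂0
  obtain ⟨C₄, hC₄, h₄⟩ := exists_ncard_badSet_le e hε₁0 hε₁1
  obtain ⟨C₅, hC₅, h₅⟩ := exists_abs_S_sub_sum_radTerm_le K s hε₁0 hε₁1
  set V : ℝ := 2 ^ d / d.factorial with hV
  have hV0 : 0 ≤ V := by positivity
  refine ⟨s * (1 + C₁ ^ s) + s * (C₄ * 2 ^ d * (2 * C₃ ^ s)) + C₁ ^ s * C₂ + C₅ * V,
    by positivity, fun k hk b hb a x hx ha => ?_⟩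
  have hkR : (2 : ℝ) ≤ k := by exact_mod_cast hk
  have hx0 : 0 < x := by linarith
  have hsR : (0 : ℝ) ≤ s := Nat.cast_nonneg s
  set q : ℝ := (k : ℝ) + 2 * s * k - 1 with hq
  have hsk : (0 : ℝ) ≤ 2 * s * k := by positivity
  have hq1 : 1 ≤ q := by rw [hq]; linarith
  have hq0 : 0 < q := by linarith
  set δ : ℝ := (k - 1) / q with hδ
  have hδ0 : 0 ≤ δ := div_nonneg (by linarith) hq0.le
  have hδ1 : δ ≤ 1 := by rw [hδ, div_le_one hq0, hq]; linarith
  -- This balances `x^(d-1) y^(2sk)`, from the tuples, against `x^d y^(-(k-1))`, from the tails: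
  -- both equal `x^(d-δ)`.
  set y : ℝ := x ^ q⁻¹ with hy
  have hy1 : 1 ≤ y := Real.one_le_rpow hx (by positivity)
  have hy0 : 0 < y := by linarith
  set F := (finite_radNorm_le (K := K) y).toFinset with hF
  set X : ℝ := x ^ ((d : ℝ) - δ + η) with hX
  -- the number of tuples
  have hFs : (F.card : ℝ) ^ s ≤ C₁ ^ s * x ^ (1 - δ) := by
    calc (F.card : ℝ) ^ s ≤ (C₁ * y ^ 2) ^ s := by gcongr; exact h₁ y
      _ = C₁ ^ s * y ^ (2 * s) := by rw [mul_pow, ← pow_mul]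
      -- The exponent is enlarged by the factor `k` to match the stated exponent: `2sk / q = 1 - δ`
      -- exactly.
      _ ≤ C₁ ^ s * y ^ (2 * s * k) := by
          refine mul_le_mul_of_nonneg_left ?_ (by positivity)
          exact pow_le_pow_right₀ hy1 (Nat.le_mul_of_pos_right _ (by omega))
      _ = C₁ ^ s * x ^ (1 - δ) := by
          rw [hy, ← Real.rpow_natCast (x ^ q⁻¹), ← Real.rpow_mul hx0.le]
          congr 2
          rw [hδ]
          field_simp
          push_cast
          rw [hq]; ring
  have hx1δ : (1 : ℝ) ≤ x ^ (1 - δ) := Real.one_le_rpow hx (by linarith)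
  have hxd : x ^ (1 - δ) * x ^ d ≤ X * x := by
    rw [hX, ← Real.rpow_natCast, ← Real.rpow_add hx0]
    nth_rewrite 3 [← Real.rpow_one x]
    rw [← Real.rpow_add hx0]
    exact Real.rpow_le_rpow_of_exponent_le hx (by linarith)
  have hxX : x ^ (1 - δ) ≤ X := Real.rpow_le_rpow_of_exponent_le hx (by linarith)
  have hyk : y ^ (-((k : ℝ) - 1 - ε₁)) ≤ x ^ (-δ + ε₁) := by
    rw [hy, ← Real.rpow_mul hx0.le]
    refine Real.rpow_le_rpow_of_exponent_le hx ?_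
    have h1 : q⁻¹ * -((k : ℝ) - 1 - ε₁) = -δ + ε₁ / q := by rw [hδ]; field_simp; ring
    rw [h1]
    linarith [div_le_self hε₁0.le hq1]
  have hxdX : x ^ d * x ^ (-δ + ε₁) ≤ X := by
    rw [hX, ← Real.rpow_natCast, ← Real.rpow_add hx0]
    exact Real.rpow_le_rpow_of_exponent_le hx (by linarith)
  -- the error terms
  have hT : 1 ≤ C₃ * x ^ ε₂ := one_le_mul_of_one_le_of_one_le hC₃ (Real.one_le_rpow hx hε₂0.le)
  have hE₁ := abs_M_sub_sum_prod_truncSum_le e (k := k) (by omega) (x := x) (y := y) hT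
    (fun c hc0 hc => h₃ k (by omega) c hc0 x hx hc y) b a ha
  have hE₁' : s * (1 + (F.card : ℝ) ^ s) ≤ s * (1 + C₁ ^ s) * X := by
    rw [mul_assoc]
    gcongr
    calc 1 + (F.card : ℝ) ^ s ≤ x ^ (1 - δ) + C₁ ^ s * x ^ (1 - δ) := add_le_add hx1δ hFs
      _ = (1 + C₁ ^ s) * x ^ (1 - δ) := by ring
      _ ≤ _ := by gcongr
  have hE₁'' : s * ((badSet e k (2 * x) y).ncard * (1 + (C₃ * x ^ ε₂) ^ s)) ≤
      s * (C₄ * 2 ^ d * (2 * C₃ ^ s)) * X := by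
    have h1 : 1 + (C₃ * x ^ ε₂) ^ s ≤ 2 * C₃ ^ s * x ^ (s * ε₂) := by
      have h2 : 1 ≤ (C₃ * x ^ ε₂) ^ s := one_le_pow₀ hT
      have h3 : (C₃ * x ^ ε₂) ^ s = C₃ ^ s * x ^ (s * ε₂) := by
        rw [mul_pow, ← Real.rpow_natCast (x ^ ε₂), ← Real.rpow_mul hx0.le, mul_comm ε₂]
      rw [h3] at h2 ⊢
      linarith
    have h2 : ((badSet e k (2 * x) y).ncard : ℝ) ≤ C₄ * (2 * x) ^ d * x ^ (-δ + ε₁) :=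
      (h₄ k hk (2 * x) y (by linarith) hy1).trans (by gcongr)
    have h3 : x ^ d * x ^ (-δ + ε₁) * x ^ (s * ε₂) ≤ X := by
      rw [hX, ← Real.rpow_natCast, ← Real.rpow_add hx0, ← Real.rpow_add hx0]
      exact Real.rpow_le_rpow_of_exponent_le hx (by linarith)
    rw [mul_assoc (s : ℝ)]
    refine mul_le_mul_of_nonneg_left ?_ hsR
    calc _ ≤ C₄ * (2 * x) ^ d * x ^ (-δ + ε₁) * (2 * C₃ ^ s * x ^ (s * ε₂)) := by gcongr
      _ = C₄ * 2 ^ d * (2 * C₃ ^ s) * (x ^ d * x ^ (-δ + ε₁) * x ^ (s * ε₂)) := by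
          rw [mul_pow]; ring
      _ ≤ _ := by gcongr
  have hE₂ : |∑ c ∈ ballFinset e x b, ∏ i, truncSum y k (c + a i) -
      (∑ A ∈ Fintype.piFinset fun _ => F, radTerm k b a A) * (V * x ^ d)| ≤ C₁ ^ s * C₂ * X := by
    refine le_of_mul_le_mul_right ?_ hx0
    calc _ ≤ (F.card : ℝ) ^ s * (C₂ * x ^ d) := h₂ k b hb a x y hx
      _ ≤ C₁ ^ s * x ^ (1 - δ) * (C₂ * x ^ d) := by gcongr
      _ = C₁ ^ s * C₂ * (x ^ (1 - δ) * x ^ d) := by ring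
      _ ≤ C₁ ^ s * C₂ * (X * x) := by gcongr
      _ = _ := by ring
  have hE₃ : |(∑ A ∈ Fintype.piFinset fun _ => F, radTerm k b a A) * (V * x ^ d) -
      S k b a * (V * x ^ d)| ≤ C₅ * V * X := by
    rw [← sub_mul, abs_mul, abs_sub_comm, abs_of_nonneg (a := V * x ^ d) (by positivity)]
    calc _ ≤ C₅ * x ^ (-δ + ε₁) * (V * x ^ d) := by
          gcongr
          exact (h₅ k hk b hb a y hy1).trans (by gcongr)
      _ = C₅ * V * (x ^ d * x ^ (-δ + ε₁)) := by ring
      _ ≤ _ := by gcongr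
  have t1 := abs_sub_le (M e k x b a : ℝ) (∑ c ∈ ballFinset e x b, ∏ i, truncSum y k (c + a i))
    (S k b a * (V * x ^ d))
  have t2 := abs_sub_le (∑ c ∈ ballFinset e x b, ∏ i, truncSum y k (c + a i))
    ((∑ A ∈ Fintype.piFinset fun _ => F, radTerm k b a A) * (V * x ^ d)) (S k b a * (V * x ^ d))
  linarith

lemma exists_abs_M_sub_le {ε : ℝ} (hε : 0 < ε) : ∃ C : ℝ, 0 < C ∧
    ∀ k : ℕ, 2 ≤ k → ∀ b : Ideal (𝓞 K), b ≠ ⊥ → ∀ (s : ℕ) (a : Fin s → 𝓞 K),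
      (¬ ∃ p : HeightOneSpectrum (𝓞 K), Obstructed k b a p) →
        ∀ x : ℝ, 1 ≤ x → (∀ i, (geomNorm e (a i) : ℝ) ≤ x) →
          |(M e k x b a : ℝ) - S k b a * (2 ^ d / d.factorial * x ^ d)| ≤
            C * x ^ ((d : ℝ) - ((k : ℝ) - 1) / ((k : ℝ) + 2 * (s : ℝ) * (k : ℝ) - 1) + ε) := by
  choose C hC h using fun s : ℕ => exists_abs_M_sub_le_of_card e s hε
  obtain ⟨C₀, hC₀, h₀⟩ := exists_ncard_ball e
  set V : ℝ := 2 ^ d / d.factorial with hV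
  have hV0 : 0 < V := by positivity
  -- For `s ≥ n` the saving is at most `1/s ≤ ε`, so `M = O(x^d)` and `0 < S ≤ 1` already suffice;
  -- the finitely many smaller `s` have their constants added up.
  set n := ⌈ε⁻¹⌉₊ with hn
  have hsum : 0 ≤ ∑ s ∈ Finset.range n, C s := Finset.sum_nonneg fun s _ => hC s
  refine ⟨∑ s ∈ Finset.range n, C s + (C₀ + V), by positivity, fun k hk b hb s a hobs x hx ha => ?_⟩
  have hx0 : 0 < x := by linarith
  have hkR : (2 : ℝ) ≤ k := by exact_mod_cast hk
  rcases lt_or_ge s n with hs | hs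
  · refine (h s k hk b hb a x hx ha).trans ?_
    gcongr
    have := Finset.single_le_sum (f := C) (fun s _ => hC s) (Finset.mem_range.2 hs)
    linarith
  · have hsε : 1 ≤ ε * s := by
      have h1 : ε⁻¹ ≤ s := (Nat.le_ceil _).trans (by exact_mod_cast hs)
      rwa [inv_le_iff_one_le_mul₀' hε] at h1
    have hδ : ((k : ℝ) - 1) / ((k : ℝ) + 2 * (s : ℝ) * (k : ℝ) - 1) ≤ ε := by
      have : (0 : ℝ) ≤ s * k := by positivity
      rw [div_le_iff₀ (by nlinarith)]
      nlinarith
    have hX : x ^ d ≤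
        x ^ ((d : ℝ) - ((k : ℝ) - 1) / ((k : ℝ) + 2 * (s : ℝ) * (k : ℝ) - 1) + ε) := by
      rw [← Real.rpow_natCast]
      exact Real.rpow_le_rpow_of_exponent_le hx (by linarith)
    have hM : (M e k x b a : ℝ) ≤ C₀ * x ^ d :=
      le_trans (by exact_mod_cast M_le_ncard_ball e k x b a) (h₀ x hx)
    have hS0 := (S_pos b a hk hb hobs).le
    have hS1 := S_le_one b a hk hb
    have hSV : S k b a * (V * x ^ d) ≤ V * x ^ d := mul_le_of_le_one_left (by positivity) hS1
    have hSV0 : 0 ≤ S k b a * (V * x ^ d) := by positivity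
    have hM0 : (0 : ℝ) ≤ M e k x b a := Nat.cast_nonneg _
    calc _ ≤ (C₀ + V) * x ^ d := by
          have hC₀x : 0 ≤ C₀ * x ^ d := by positivity
          have hVx : 0 ≤ V * x ^ d := by positivity
          rw [abs_le, add_mul]
          constructor <;> linarith
      _ ≤ _ := mul_le_mul (by linarith) hX (by positivity) (by positivity)

end Asymptotic

end KFree

theorem mainTheorem3 (K : Type*) [Field K] [NumberField K]
    (e : Module.Basis (Fin (Module.finrank ℚ K)) ℤ (𝓞 K)) :
    -- the obstructed case
    (∀ k : ℕ, 2 ≤ k → ∀ b : Ideal (𝓞 K), b ≠ ⊥ → ∀ (s : ℕ) (a : Fin s → 𝓞 K),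
      (∃ p : HeightOneSpectrum (𝓞 K), KFree.Obstructed k b a p) →
        ∀ x : ℝ, KFree.M e k x b a = 0) ∧
    -- otherwise the series converges absolutely, is positive and has an Euler product
    (∀ k : ℕ, 2 ≤ k → ∀ b : Ideal (𝓞 K), b ≠ ⊥ → ∀ (s : ℕ) (a : Fin s → 𝓞 K),
      (¬ ∃ p : HeightOneSpectrum (𝓞 K), KFree.Obstructed k b a p) →
        Summable (KFree.STerm k b a) ∧
        0 < KFree.S k b a ∧
        HasProd
          (fun p : {p : HeightOneSpectrum (𝓞 K) // ¬ b ≤ p.asIdeal ^ k} =>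
            KFree.eulerFactor k b a p)
          ((Ideal.absNorm b : ℝ) * KFree.S k b a)) ∧
    -- the asymptotic formula, with a constant depending on the basis and on `ε` only
    (∀ ε : ℝ, 0 < ε → ∃ C : ℝ, 0 < C ∧
      ∀ k : ℕ, 2 ≤ k → ∀ b : Ideal (𝓞 K), b ≠ ⊥ → ∀ (s : ℕ) (a : Fin s → 𝓞 K),
        (¬ ∃ p : HeightOneSpectrum (𝓞 K), KFree.Obstructed k b a p) →
          ∀ x : ℝ, 1 ≤ x → (∀ i, (KFree.geomNorm e (a i) : ℝ) ≤ x) →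
            |(KFree.M e k x b a : ℝ) -
                KFree.S k b a *
                  (2 ^ Module.finrank ℚ K / (Module.finrank ℚ K).factorial *
                    x ^ Module.finrank ℚ K)| ≤
              C * x ^ ((Module.finrank ℚ K : ℝ) -
                ((k : ℝ) - 1) / ((k : ℝ) + 2 * (s : ℝ) * (k : ℝ) - 1) + ε)) := by
  refine ⟨fun k _ b _ s a ⟨p, hp⟩ x => KFree.M_eq_zero_of_obstructed b a e hp x,
    fun k hk b hb s a hobs => ⟨KFree.summable_STerm b a hk hb, KFree.S_pos b a hk hb hobs,
      KFree.hasProd_eulerFactor_subtype b a hk hb hobs⟩,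
    fun ε hε => KFree.exists_abs_M_sub_le e hε⟩
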